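/- Let $x_1,\dots,x_n$ be distinct points of $\mathbb P^2_{\mathbb C}$ (in particular, $n$ very general points), let $f\colon X_n\to\mathbb P^2$ be the blow-up of the plane at these points, with line class $L=f^*\mathcal O_{\mathbb P^2}(1)$ and exceptional curves $E_1,\dots,E_n$, so that $\mathrm{Pic}(X_n)$ is free on $L,E_1,\dots,E_n$, and let $N_1(X_n)=\mathrm{Pic}(X_n)\otimes_{\mathbb Z}\mathbb R$ carry the intersection form ($L^2=1$, $E_i^2=-1$, all other products of basis elements $0$). Write $K_n=-3L+\sum_i E_i$ for the canonical class. A class $dL-\sum_i m_iE_i$ in $\mathrm{Pic}(X_n)$ is effective if it has a nonzero global section, i.e. if there is a nonzero ternary form of degree $d$ that vanishes to order at least $m_i$ at $x_i$ for every $i$ (no condition when $m_i\le 0$). The ray of a nonzero $\xi\in N_1(X_n)$ is $[\xi]=\{\lambda\xi:\lambda>0\}$; a ray is rational if it is generated by a class in $\mathrm{Pic}(X_n)\otimes\mathbb Q$, and effective if it is generated by an effective class. Let $\overline{\mathrm{NE}}(X_n)$ (the Mori cone) be the closure of the union of all effective rays, let $\mathrm{Nef}(X_n)$ (the nef cone)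 be the set of $\xi\in N_1(X_n)$ with $\xi\cdot D\ge 0$ for every effective class $D$, and let $\mathcal Q_n=\{\xi\in N_1(X_n):\xi\cdot L\ge 0,\ \xi^2\ge 0\}$ be the nonnegative cone, with boundary $\partial\mathcal Q_n$. A ray $\rho$ contained in a cone $A$ is extremal for $A$ if, whenever $\alpha,\beta\in A$ and $\alpha+\beta\in\rho$, both $\alpha$ and $\beta$ lie in $\rho\cup\{0\}$. Then every rational ray $\rho\subseteq\partial\mathcal Q_n$ that is not effective is nef, i.e. $\rho\subseteq\mathrm{Nef}(X_n)$, and is extremal for both $\overline{\mathrm{NE}}(X_n)$ and $\mathrm{Nef}(X_n)$. Moreover, $\rho\subseteq\partial\mathcal Q_n\cap\{\xi\in\overline{\mathrm{NE}}(X_n):\xi\cdot K_n\ge 0\}$. -/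

import Mathlib

/-!
Divisor classes on the blow-up `f : X → ℙ²` of the complex projective plane at `n` distinct
points `x 0, …, x (n-1)`.  With `L` the pull-back of a line and `E i` the exceptional curve over
`x i`, the group `Pic X` is free on `L, E 0, …, E (n-1)`.  The class `d L - ∑ i, m i • E i` is
written `(d, m)`, and `H⁰(X, d L - ∑ i, m i • E i)` is the space of ternary forms of degree `d`
with multiplicity at least `m i` at every `x i` (no condition at `x i` when `m i ≤ 0`).
-/

namespace BlownUpPlane

/-- Closed points of the complex projective plane. -/
abbrev Plane : Type := Projectivization ℂ (Fin 3 → ℂ)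

/-- `F` vanishes to order at least `m` at `v`: the Taylor expansion `F (v + Y)` has no term of
degree smaller than `m` in `Y`. For `m ≤ 0` there is no condition. -/
def VanishesToOrder (F : MvPolynomial (Fin 3) ℂ) (v : Fin 3 → ℂ) (m : ℤ) : Prop :=
  ∀ s : Fin 3 →₀ ℕ, (s.degree : ℤ) < m →
    MvPolynomial.coeff s
      (MvPolynomial.aeval (fun j => MvPolynomial.X j + MvPolynomial.C (v j)) F :
        MvPolynomial (Fin 3) ℂ) = 0

/-- `Pic X`: the pair `(d, m)` is the class `d L - ∑ i, m i • E i`. -/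
abbrev Pic (n : ℕ) : Type := ℤ × (Fin n → ℤ)

/-- `N₁(X) = Pic X ⊗ ℝ`, in coordinates with respect to the basis `(L, -E 0, …, -E (n-1))`. -/
abbrev N1 (n : ℕ) : Type := ℝ × (Fin n → ℝ)

variable {n : ℕ}

/-- The inclusion of `Pic X` in `N₁(X)`. -/
def Pic.toN1 (D : Pic n) : N1 n := ((D.1 : ℝ), fun i => (D.2 i : ℝ))

/-- The intersection form: `L² = 1`, `E i ² = -1`, all other products of basis elements are `0`. -/
def inter (ξ η : N1 n) : ℝ := ξ.1 * η.1 - ∑ i, ξ.2 i * η.2 i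

/-- The class `L` of the pull-back of a line. -/
def lineClass (n : ℕ) : N1 n := (1, fun _ => 0)

/-- The canonical class `K = -3 L + ∑ i, E i`. -/
def canonicalClass (n : ℕ) : N1 n := (-3, fun _ => -1)

/-- The forms that define the linear system `|d L - ∑ i, m i • E i|`: ternary forms of degree `d`
with multiplicity at least `m i` at `x i`. The multiplicity of a form at a point of the plane is
its order of vanishing at any vector that represents the point. -/
def linearSystem (x : Fin n → Plane) (D : Pic n) : Set (MvPolynomial (Fin 3) ℂ) :=
  {F | (∃ d : ℕ, (d : ℤ) = D.1 ∧ F.IsHomogeneous d) ∧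
    ∀ i, VanishesToOrder F (x i).rep (D.2 i)}

/-- A class in `Pic X` is effective if it has a nonzero section. -/
def IsEffective (x : Fin n → Plane) (D : Pic n) : Prop :=
  ∃ F ∈ linearSystem x D, F ≠ 0

/-- The open half-line spanned by `ξ`. -/
def ray (ξ : N1 n) : Set (N1 n) := {η | ∃ c : ℝ, 0 < c ∧ η = c • ξ}

/-- A class in `N₁(X)` is rational if it lies in `Pic X ⊗ ℚ`. -/
def IsRational (ξ : N1 n) : Prop :=
  (∃ q : ℚ, ξ.1 = q) ∧ ∀ i, ∃ q : ℚ, ξ.2 i = q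

/-- A rational ray is a ray generated by a nonzero rational class. -/
def IsRationalRay (ρ : Set (N1 n)) : Prop :=
  ∃ ξ : N1 n, ξ ≠ 0 ∧ IsRational ξ ∧ ρ = ray ξ

/-- An effective ray is a ray generated by a nonzero effective class. -/
def IsEffectiveRay (x : Fin n → Plane) (ρ : Set (N1 n)) : Prop :=
  ∃ D : Pic n, D ≠ 0 ∧ IsEffective x D ∧ ρ = ray D.toN1

/-- The Mori cone: the closure of the union of all effective rays. -/
def moriCone (x : Fin n → Plane) : Set (N1 n) :=
  closure (⋃₀ {ρ | IsEffectiveRay x ρ})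

/-- The nef cone: the classes whose intersection with every effective class is nonnegative. -/
def nefCone (x : Fin n → Plane) : Set (N1 n) :=
  {ξ | ∀ D : Pic n, IsEffective x D → 0 ≤ inter ξ D.toN1}

/-- The nonnegative cone: `ξ · L ≥ 0` and `ξ² ≥ 0`. -/
def nonnegCone (n : ℕ) : Set (N1 n) :=
  {ξ | 0 ≤ inter ξ (lineClass n) ∧ 0 ≤ inter ξ ξ}

/-- The part of the Mori cone on which the intersection with `K` is nonnegative. -/
def moriConeKNonneg (x : Fin n → Plane) : Set (N1 n) :=
  {ξ ∈ moriCone x | 0 ≤ inter ξ (canonicalClass n)}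

/-- The ray `ρ` is extremal for the cone `A`: it lies in `A`, and if a sum of two elements of `A`
is on `ρ`, then both summands are on `ρ` or zero. -/
def IsExtremalRay (A ρ : Set (N1 n)) : Prop :=
  ρ ⊆ A ∧ ∀ α ∈ A, ∀ β ∈ A, α + β ∈ ρ → α ∈ insert 0 ρ ∧ β ∈ insert 0 ρ

end BlownUpPlane

/-! After clearing denominators the ray is generated by an integral class `D₀` with `D₀² = 0` and
`D₀ · L > 0`, and no positive multiple of `D₀` is effective. Counting conditions on ternary forms
gives the Riemann–Roch statement that `D · L ≥ 0` and `D² ≥ D · K` make `D` effective. Applied to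
`D₀` itself, this yields `D₀ · K ≥ 0`. If an effective `D` had `D₀ · D < 0`, then `N D₀ - D` would
have positive square for large `N`, so a multiple of it, and hence a multiple of `D₀`, would be
effective. Thus `D₀` is nef.

Riemann–Roch also gives `Q ⊆ NE`, and duality gives `Nef ⊆ Q`. For nef `α, β` with `α + β` on the
ray, the nonnegative numbers `α²`, `α · β`, `β²` must all vanish. The form is negative semidefinite
on the orthogonal complement of `D₀`, with only multiples of `D₀` as null vectors, so `α` and `β`
are proportional to `D₀`.

For the Mori cone, summands of a point of the ray are orthogonal to `D₀`, since `D₀` is nef. The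
irreducible curves orthogonal to `D₀` are linearly independent, hence finite in number
(`linearIndependent_orthogonalCurve`). A Zariski-type decomposition writes every `α` in the Mori
cone with `D₀ · α = 0` as a nonnegative multiple of `D₀` plus a nonnegative combination of these
curves (`exists_eq_smul_add_sum`). No nontrivial nonnegative combination of nonzero effective
classes lies on the line of `D₀` (`eq_zero_of_sum_smul_eq`): simultaneous Diophantine approximation
would turn one on the positive side into an effective multiple of `D₀`, and an ample class excludes
the other side. So the curve parts vanish.

The only geometric input is that distinct irreducible curves meet nonnegatively; this is Bézout's
inequality, obtained by dimension counts. -/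

namespace BlownUpPlane

open MvPolynomial

/-! ### Order of vanishing of a polynomial at a point -/

section Order

/-- The Taylor expansion `F (v + Y)` of a ternary polynomial at `v`. -/
noncomputable def taylor (v : Fin 3 → ℂ) : MvPolynomial (Fin 3) ℂ →ₐ[ℂ] MvPolynomial (Fin 3) ℂ :=
  aeval fun j => X j + C (v j)

theorem taylor_injective (v : Fin 3 → ℂ) : Function.Injective (taylor v) := by
  have h : (taylor (-v)).comp (taylor v) = AlgHom.id ℂ _ := by
    ext j : 1
    simp [taylor]
  intro F G hFG
  have := congrArg (taylor (-v)) hFG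
  rw [← AlgHom.comp_apply, ← AlgHom.comp_apply, h] at this
  exact this

theorem totalDegree_taylor_le (v : Fin 3 → ℂ) (F : MvPolynomial (Fin 3) ℂ) :
    (taylor v F).totalDegree ≤ F.totalDegree := by
  rw [taylor, aeval_def, eval₂_eq]
  refine totalDegree_finsetSum_le fun s hs => ?_
  refine (totalDegree_mul _ _).trans ?_
  have h0 : (algebraMap ℂ (MvPolynomial (Fin 3) ℂ) (coeff s F)).totalDegree = 0 :=
    totalDegree_C _
  rw [h0, zero_add]
  refine (totalDegree_finsetProd _ _).trans (le_trans ?_ (le_totalDegree hs))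
  refine Finset.sum_le_sum fun j _ => (totalDegree_pow _ _).trans ?_
  have h1 : (X j + C (v j) : MvPolynomial (Fin 3) ℂ).totalDegree ≤ 1 :=
    (totalDegree_add _ _).trans (by simp)
  nlinarith

/-- The order of vanishing of a ternary polynomial at `v`. -/
noncomputable def ord (v : Fin 3 → ℂ) (F : MvPolynomial (Fin 3) ℂ) : ℕ∞ :=
  (taylor v F : MvPowerSeries (Fin 3) ℂ).order

theorem le_order_coe_iff (G : MvPolynomial (Fin 3) ℂ) (m : ℕ) :
    (m : ℕ∞) ≤ (G : MvPowerSeries (Fin 3) ℂ).order ↔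
      ∀ s : Fin 3 →₀ ℕ, s.degree < m → coeff s G = 0 := by
  constructor
  · intro h s hs
    rw [← coeff_coe]
    exact MvPowerSeries.coeff_of_lt_order (lt_of_lt_of_le (by exact_mod_cast hs) h)
  · intro h
    exact MvPowerSeries.nat_le_order fun s hs => by rw [coeff_coe]; exact h s hs

theorem vanishesToOrder_iff (F : MvPolynomial (Fin 3) ℂ) (v : Fin 3 → ℂ) (m : ℤ) :
    VanishesToOrder F v m ↔ (m.toNat : ℕ∞) ≤ ord v F := by
  rw [ord, le_order_coe_iff]
  exact forall_congr' fun s => by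
    rw [show ((s.degree : ℤ) < m ↔ s.degree < m.toNat) by omega]; rfl

theorem ord_mul (v : Fin 3 → ℂ) (F G : MvPolynomial (Fin 3) ℂ) :
    ord v (F * G) = ord v F + ord v G := by
  simp [ord, MvPowerSeries.order_mul]

theorem ord_one (v : Fin 3 → ℂ) : ord v 1 = 0 := by
  have h : ((1 : MvPowerSeries (Fin 3) ℂ)).order = 0 := MvPowerSeries.weightedOrder_one _
  simp [ord, h]

theorem ord_pow (v : Fin 3 → ℂ) (F : MvPolynomial (Fin 3) ℂ) (k : ℕ) :
    ord v (F ^ k) = k * ord v F := by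
  induction k with
  | zero => simp [ord_one]
  | succ k ih => rw [pow_succ, ord_mul, ih]; push_cast; ring

theorem order_coe_le_totalDegree {G : MvPolynomial (Fin 3) ℂ} (hG : G ≠ 0) :
    (G : MvPowerSeries (Fin 3) ℂ).order ≤ G.totalDegree := by
  obtain ⟨s, hs⟩ := ne_zero_iff.mp hG
  refine (MvPowerSeries.order_le (d := s) (by rwa [coeff_coe])).trans ?_
  exact_mod_cast (le_totalDegree (mem_support_iff.mpr hs))

theorem ord_le_of_isHomogeneous {F : MvPolynomial (Fin 3) ℂ} {d : ℕ} (hF : F.IsHomogeneous d)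
    (h0 : F ≠ 0) (v : Fin 3 → ℂ) : ord v F ≤ d := by
  refine (order_coe_le_totalDegree fun h => h0 (taylor_injective v (by simpa using h))).trans ?_
  exact_mod_cast (totalDegree_taylor_le v F).trans hF.totalDegree_le

/-- The order of vanishing of a nonzero polynomial, as a natural number. -/
noncomputable def mult (v : Fin 3 → ℂ) (F : MvPolynomial (Fin 3) ℂ) : ℕ := (ord v F).toNat

theorem coe_mult {F : MvPolynomial (Fin 3) ℂ} (h0 : F ≠ 0) (v : Fin 3 → ℂ) :
    (mult v F : ℕ∞) = ord v F := by
  refine ENat.natCast_toNat fun h => h0 (taylor_injective v ?_)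
  rw [ord, MvPowerSeries.order_eq_top_iff] at h
  rw [map_zero]
  exact coe_injective _ _ (by rw [h, coe_zero])

theorem mult_mul {F G : MvPolynomial (Fin 3) ℂ} (hF : F ≠ 0) (hG : G ≠ 0) (v : Fin 3 → ℂ) :
    mult v (F * G) = mult v F + mult v G := by
  have := ord_mul v F G
  rw [← coe_mult hF, ← coe_mult hG, ← coe_mult (mul_ne_zero hF hG)] at this
  exact_mod_cast this

/-- Detects forms by two additive invariants, the degree and the order at the origin, so that
homogeneity passes to factors. -/
theorem isHomogeneous_iff_le_order {G : MvPolynomial (Fin 3) ℂ} :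
    G.IsHomogeneous G.totalDegree ↔
      (G.totalDegree : ℕ∞) ≤ (G : MvPowerSeries (Fin 3) ℂ).order := by
  rw [le_order_coe_iff]
  constructor
  · intro h s hs
    exact h.coeff_eq_zero hs.ne
  · intro h s hs
    have h1 := le_totalDegree (mem_support_iff.mpr hs)
    have h2 : ¬ s.degree < G.totalDegree := fun hlt => hs (h s hlt)
    have h3 : s.degree = s.sum fun _ e => e := rfl
    have : s.degree = G.totalDegree := by omega
    rw [← this, Finsupp.degree_eq_weight_one]
    rfl

/-- A factor of a nonzero form is a form. -/
theorem isHomogeneous_left_of_mul {F G : MvPolynomial (Fin 3) ℂ} {d : ℕ}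
    (h : (F * G).IsHomogeneous d) (hF : F ≠ 0) (hG : G ≠ 0) : F.IsHomogeneous F.totalDegree := by
  have hne := mul_ne_zero hF hG
  have hd : (F * G).totalDegree = d := h.totalDegree hne
  have h1 := isHomogeneous_iff_le_order.mp (hd ▸ h)
  -- Degree and order are additive and the order never exceeds the degree, so equality for the
  -- product forces equality for each factor.
  rw [totalDegree_mul_of_isDomain hF hG, coe_mul, MvPowerSeries.order_mul] at h1
  rw [isHomogeneous_iff_le_order]
  have h3 := order_coe_le_totalDegree hG
  push_cast at h1
  have h4 := h1.trans (add_le_add_right h3 _)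
  exact (ENat.add_le_add_iff_right (ENat.natCast_ne_top _)).mp h4

end Order

/-! ### Linear changes of coordinates -/

section LinearSubstitution

/-- Substitution of a linear map in a ternary polynomial: `F ↦ F (A Y)`. -/
noncomputable def linSubst (A : (Fin 3 → ℂ) →ₗ[ℂ] (Fin 3 → ℂ)) :
    MvPolynomial (Fin 3) ℂ →ₐ[ℂ] MvPolynomial (Fin 3) ℂ :=
  aeval fun j => ∑ k, C (A (Pi.single k 1) j) * X k

theorem apply_eq_sum (A : (Fin 3 → ℂ) →ₗ[ℂ] (Fin 3 → ℂ)) (v : Fin 3 → ℂ) (j : Fin 3) :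
    A v j = ∑ k, A (Pi.single k 1) j * v k := by
  conv_lhs => rw [← Finset.univ_sum_single v]
  rw [map_sum, Finset.sum_apply]
  refine Finset.sum_congr rfl fun k _ => ?_
  have : (Pi.single k (v k) : Fin 3 → ℂ) = v k • Pi.single k 1 := by
    rw [← Pi.single_smul]; simp
  rw [this, map_smul, Pi.smul_apply, smul_eq_mul, mul_comm]

theorem linSubst_comp (A B : (Fin 3 → ℂ) →ₗ[ℂ] (Fin 3 → ℂ)) :
    (linSubst B).comp (linSubst A) = linSubst (A ∘ₗ B) := by
  ext j : 1
  simp only [linSubst, AlgHom.comp_apply, aeval_X, map_sum, map_mul, aeval_C, LinearMap.comp_apply]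
  simp only [Finset.mul_sum, MvPolynomial.algebraMap_eq]
  rw [Finset.sum_comm]
  refine Finset.sum_congr rfl fun k _ => ?_
  rw [apply_eq_sum A (B (Pi.single k 1)), map_sum, Finset.sum_mul]
  exact Finset.sum_congr rfl fun l _ => by rw [C_mul]; ring

theorem linSubst_id : linSubst LinearMap.id = AlgHom.id ℂ _ := by
  ext j : 1
  simp only [linSubst, aeval_X, LinearMap.id_apply, AlgHom.id_apply]
  rw [Finset.sum_eq_single j]
  · simp
  · intro k _ hk
    simp [hk.symm]
  · simp

theorem linSubst_symm_linSubst (A : (Fin 3 → ℂ) ≃ₗ[ℂ] (Fin 3 → ℂ)) (F : MvPolynomial (Fin 3) ℂ) :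
    linSubst A.symm.toLinearMap (linSubst A.toLinearMap F) = F := by
  rw [← AlgHom.comp_apply, linSubst_comp]
  simp [linSubst_id]

theorem isHomogeneous_linSubst (A : (Fin 3 → ℂ) →ₗ[ℂ] (Fin 3 → ℂ)) {F : MvPolynomial (Fin 3) ℂ}
    {d : ℕ} (hF : F.IsHomogeneous d) : (linSubst A F).IsHomogeneous d := by
  have := hF.aeval (fun j => ∑ k, C (A (Pi.single k 1) j) * X k) (n := 1)
    (fun j => IsHomogeneous.sum _ _ _ fun k _ => isHomogeneous_C_mul_X _ _)
  rwa [one_mul] at this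

/-- A linear substitution maps each homogeneous component to a form of the same degree, so no terms
of lower degree appear. The map need not be invertible; a projection is used later. -/
theorem order_le_order_linSubst (A : (Fin 3 → ℂ) →ₗ[ℂ] (Fin 3 → ℂ)) (G : MvPolynomial (Fin 3) ℂ) :
    (G : MvPowerSeries (Fin 3) ℂ).order ≤ (linSubst A G : MvPowerSeries (Fin 3) ℂ).order := by
  refine ENat.forall_natCast_le_iff_le.mp fun m hm => ?_
  rw [le_order_coe_iff] at hm ⊢
  intro s hs
  conv_lhs => rw [← sum_homogeneousComponent G]
  rw [map_sum, coeff_sum]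
  refine Finset.sum_eq_zero fun i _ => ?_
  by_cases hi : s.degree = i
  · have : homogeneousComponent i G = 0 := by
      ext t
      rw [coeff_homogeneousComponent]
      split_ifs with ht
      · simpa using hm t (by omega)
      · simp
    simp [this]
  · exact (isHomogeneous_linSubst A (homogeneousComponent_isHomogeneous i G)).coeff_eq_zero hi

theorem taylor_linSubst (A : (Fin 3 → ℂ) →ₗ[ℂ] (Fin 3 → ℂ)) (v : Fin 3 → ℂ)
    (F : MvPolynomial (Fin 3) ℂ) : taylor v (linSubst A F) = linSubst A (taylor (A v) F) := by
  have : (taylor v).comp (linSubst A) = (linSubst A).comp (taylor (A v)) := by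
    ext j : 1
    simp only [linSubst, taylor, AlgHom.comp_apply, aeval_X, map_sum, map_mul, aeval_C, map_add,
      MvPolynomial.algebraMap_eq]
    rw [apply_eq_sum A v, map_sum, ← Finset.sum_add_distrib]
    exact Finset.sum_congr rfl fun k _ => by rw [C_mul]; ring
  exact DFunLike.congr_fun this F

theorem ord_linSubst (A : (Fin 3 → ℂ) ≃ₗ[ℂ] (Fin 3 → ℂ)) (v : Fin 3 → ℂ)
    (F : MvPolynomial (Fin 3) ℂ) : ord v (linSubst A.toLinearMap F) = ord (A v) F := by
  rw [ord, taylor_linSubst]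
  refine le_antisymm ?_ (order_le_order_linSubst _ _)
  have := order_le_order_linSubst A.symm.toLinearMap (linSubst A.toLinearMap (taylor (A v) F))
  rwa [linSubst_symm_linSubst] at this

theorem exists_linearEquiv_apply_eq {v w : Fin 3 → ℂ} (hv : v ≠ 0) (hw : w ≠ 0) :
    ∃ A : (Fin 3 → ℂ) ≃ₗ[ℂ] (Fin 3 → ℂ), A v = w := by
  obtain ⟨A, hA⟩ := SeparatingDual.exists_continuousLinearEquiv_apply_eq (R := ℂ) hv hw
  exact ⟨A.toLinearEquiv, hA⟩

end LinearSubstitution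

end BlownUpPlane

namespace BlownUpPlane

open MvPolynomial

/-! ### Dimension of the space of forms with one multiple point -/

section Dimension

/-- Ternary forms of degree `d`. -/
noncomputable abbrev forms (d : ℕ) : Submodule ℂ (MvPolynomial (Fin 3) ℂ) :=
  homogeneousSubmodule (Fin 3) ℂ d

instance (d : ℕ) : FiniteDimensional ℂ (forms d) :=
  Module.Finite.iff_fg.mpr (homogeneousSubmodule_fg (σ := Fin 3) (R := ℂ) d)

/-- Polynomials that vanish to order at least `m` at `v`. -/
noncomputable def vanishing (v : Fin 3 → ℂ) (m : ℕ) : Submodule ℂ (MvPolynomial (Fin 3) ℂ) where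
  carrier := {F | (m : ℕ∞) ≤ ord v F}
  zero_mem' := by simp [ord]
  add_mem' {F G} hF hG := by
    simp only [Set.mem_ofPred_eq, ord, map_add, coe_add] at *
    exact (le_min hF hG).trans MvPowerSeries.min_order_le_add
  smul_mem' c F hF := by
    simp only [Set.mem_ofPred_eq, ord, map_smul, coe_smul] at *
    exact hF.trans MvPowerSeries.le_order_smul

theorem mem_vanishing {v : Fin 3 → ℂ} {m : ℕ} {F : MvPolynomial (Fin 3) ℂ} :
    F ∈ vanishing v m ↔ (m : ℕ∞) ≤ ord v F := Iff.rfl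

theorem one_le_ord_X {v : Fin 3 → ℂ} {j : Fin 3} (hj : v j = 0) :
    1 ≤ ord v (X j) := by
  have : taylor v (X j) = X j := by simp [taylor, hj]
  rw [ord, this, ← Nat.cast_one, le_order_coe_iff]
  intro s hs
  exact (isHomogeneous_X ℂ j).coeff_eq_zero hs.ne

/-- At the coordinate point `(0, 0, 1)` multiplicity is read off from the monomials of a form:
dehomogenizing loses nothing, because the degree determines the exponent of the last variable. -/
theorem le_ord_single_iff {F : MvPolynomial (Fin 3) ℂ} {d : ℕ} (hF : F.IsHomogeneous d) (m : ℕ) :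
    (m : ℕ∞) ≤ ord (Pi.single 2 1) F ↔ ∀ s : Fin 3 →₀ ℕ, s 0 + s 1 < m → coeff s F = 0 := by
  constructor
  · intro h s hs
    by_contra hne
    -- Killing the last variable after the expansion turns `F` into `F(X₀, X₁, 1)` and cannot lower
    -- the order.
    have hproj := h.trans (order_le_order_linSubst
      (LinearMap.pi ![LinearMap.proj 0, LinearMap.proj 1, 0]) _)
    rw [le_order_coe_iff] at hproj
    have hcomp : linSubst (LinearMap.pi ![LinearMap.proj 0, LinearMap.proj 1, 0])
        (taylor (Pi.single 2 1) F) = aeval ![X 0, X 1, 1] F := by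
      rw [← AlgHom.comp_apply]
      congr 1
      ext j : 1
      fin_cases j <;> simp [linSubst, taylor, Fin.sum_univ_three]
    have hcoeff : coeff (s.erase 2) (aeval ![X 0, X 1, 1] F : MvPolynomial (Fin 3) ℂ)
        = coeff s F := by
      have hterm : ∀ u : Fin 3 →₀ ℕ, (algebraMap ℂ (MvPolynomial (Fin 3) ℂ) (coeff u F) *
          ∏ i, (![X 0, X 1, 1] : Fin 3 → MvPolynomial (Fin 3) ℂ) i ^ u i) =
          monomial (u.erase 2) (coeff u F) := by
        intro u
        rw [monomial_eq, Finsupp.prod_fintype _ _ (by simp)]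
        simp [Fin.prod_univ_three]
      rw [aeval_def, eval₂_eq', coeff_sum]
      simp only [hterm, coeff_monomial]
      rw [Finset.sum_eq_single s]
      · simp
      · intro u hu hus
        rw [if_neg]
        intro he
        apply hus
        have hdu : u.degree = d := by
          by_contra hd
          exact mem_support_iff.mp hu (hF.coeff_eq_zero hd)
        have hds : s.degree = d := by
          by_contra hd
          exact hne (hF.coeff_eq_zero hd)
        have h0 := DFunLike.congr_fun he 0
        have h1 := DFunLike.congr_fun he 1
        simp at h0 h1
        rw [Finsupp.degree_eq_sum, Fin.sum_univ_three] at hdu hds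
        ext j
        fin_cases j
        · exact h0
        · exact h1
        · show u 2 = s 2
          omega
      · intro hns
        simpa using hns
    rw [hcomp] at hproj
    apply hne
    rw [← hcoeff]
    apply hproj
    rw [Finsupp.degree_eq_sum, Fin.sum_univ_three]
    simpa using hs
  · intro h
    rw [← mem_vanishing, F.as_sum]
    refine Submodule.sum_mem _ fun s hs => ?_
    rw [mem_vanishing, monomial_eq, Finsupp.prod_fintype _ _ (by simp), Fin.prod_univ_three]
    simp only [ord_mul, ord_pow]
    have hs' : m ≤ s 0 + s 1 := by
      by_contra hlt
      exact mem_support_iff.mp hs (h s (by omega))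
    have h0 : 1 ≤ ord (Pi.single 2 1 : Fin 3 → ℂ) (X 0) := one_le_ord_X (by simp)
    have h1 : 1 ≤ ord (Pi.single 2 1 : Fin 3 → ℂ) (X 1) := one_le_ord_X (by simp)
    calc (m : ℕ∞) ≤ (s 0 : ℕ∞) * 1 + (s 1 : ℕ∞) * 1 := by
          rw [mul_one, mul_one]; exact_mod_cast hs'
      _ ≤ (s 0 : ℕ∞) * ord (Pi.single 2 1) (X 0) + (s 1 : ℕ∞) * ord (Pi.single 2 1) (X 1) := by
          gcongr
      _ ≤ _ := by
          exact le_add_left le_self_add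

/-- The exponents `(b, k - b, d - k)` with `b ≤ k < m`. -/
noncomputable def jetExponent (d : ℕ) {m : ℕ} (p : Σ k : Fin m, Fin (k + 1)) : Fin 3 →₀ ℕ :=
  Finsupp.equivFunOnFinite.symm ![p.2, p.1 - p.2, d - p.1]

theorem jetExponent_injective (d m : ℕ) :
    Function.Injective (jetExponent d : (Σ k : Fin m, Fin (k + 1)) → _) := by
  rintro ⟨⟨k, hk⟩, ⟨b, hb⟩⟩ ⟨⟨k', hk'⟩, ⟨b', hb'⟩⟩ h
  have h0 : b = b' := DFunLike.congr_fun h 0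
  have h1 : k - b = k' - b' := DFunLike.congr_fun h 1
  simp only at hb hb'
  obtain rfl : k = k' := by omega
  subst h0
  rfl

theorem degree_jetExponent {d m : ℕ} (hm : m ≤ d + 1) (p : Σ k : Fin m, Fin (k + 1)) :
    (jetExponent d p).degree = d := by
  obtain ⟨⟨k, hk⟩, ⟨b, hb⟩⟩ := p
  simp only at hb
  rw [Finsupp.degree_eq_sum, Fin.sum_univ_three]
  show b + (k - b) + (d - k) = d
  omega

theorem exists_jetExponent_eq {d m : ℕ} {s : Fin 3 →₀ ℕ} (hs : s.degree = d)
    (hm : s 0 + s 1 < m) : ∃ p : Σ k : Fin m, Fin (k + 1), jetExponent d p = s := by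
  rw [Finsupp.degree_eq_sum, Fin.sum_univ_three] at hs
  refine ⟨⟨⟨s 0 + s 1, hm⟩, ⟨s 0, by simp⟩⟩, ?_⟩
  ext j
  fin_cases j
  · rfl
  · show s 0 + s 1 - s 0 = s 1
    omega
  · show d - (s 0 + s 1) = s 2
    omega

theorem two_mul_card_jet (m : ℕ) :
    2 * Fintype.card (Σ k : Fin m, Fin (k + 1)) = m * (m + 1) := by
  rw [Fintype.card_sigma]
  simp only [Fintype.card_fin]
  rw [Fin.sum_univ_eq_sum_range (fun k => k + 1) m]
  induction m with
  | zero => simp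
  | succ m ih => rw [Finset.sum_range_succ, mul_add, ih]; ring

/-- Once `v` is moved to `(0, 0, 1)`, the conditions say that the coefficients at the exponents
`jetExponent d p` vanish. For `m ≤ d + 1` these are distinct exponents of degree `d`, so the
conditions are independent. Doubling avoids division in `m (m + 1) / 2`. -/
theorem finrank_forms_inf_vanishing_of_le {d m : ℕ} (hm : m ≤ d + 1) {v : Fin 3 → ℂ} (hv : v ≠ 0) :
    2 * Module.finrank ℂ (forms d ⊓ vanishing v m : Submodule ℂ (MvPolynomial (Fin 3) ℂ))
      + m * (m + 1) = 2 * Module.finrank ℂ (forms d) := by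
  obtain ⟨A, hA⟩ := exists_linearEquiv_apply_eq (v := Pi.single 2 1) (w := v) (by simp) hv
  let Λ : forms d →ₗ[ℂ] ((Σ k : Fin m, Fin (k + 1)) → ℂ) :=
    LinearMap.pi fun p => (lcoeff ℂ (jetExponent d p)) ∘ₗ
      (linSubst A.toLinearMap).toLinearMap ∘ₗ (forms d).subtype
  have hsurj : LinearMap.range Λ = ⊤ := by
    rw [LinearMap.range_eq_top]
    intro g
    let G : MvPolynomial (Fin 3) ℂ := ∑ p, monomial (jetExponent d p) (g p)
    have hG : G.IsHomogeneous d := IsHomogeneous.sum _ _ _ fun p _ =>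
      isHomogeneous_monomial _ (degree_jetExponent hm p)
    refine ⟨⟨linSubst A.symm.toLinearMap G, isHomogeneous_linSubst _ hG⟩, ?_⟩
    ext p
    have := linSubst_symm_linSubst A.symm G
    rw [LinearEquiv.symm_symm] at this
    simp only [Λ, LinearMap.pi_apply, LinearMap.comp_apply, Submodule.subtype_apply,
      AlgHom.toLinearMap_apply, this, lcoeff_apply, G, coeff_sum, coeff_monomial]
    rw [Finset.sum_eq_single p]
    · simp
    · intro q _ hq
      rw [if_neg fun h => hq (jetExponent_injective d m h)]
    · simp
  have hker : (LinearMap.ker Λ).map (forms d).subtype = forms d ⊓ vanishing v m := by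
    ext F
    rw [Submodule.mem_map, Submodule.mem_inf, mem_vanishing]
    constructor
    · rintro ⟨⟨F, hF⟩, hk, rfl⟩
      refine ⟨hF, ?_⟩
      rw [Submodule.subtype_apply, ← hA, ← ord_linSubst,
        le_ord_single_iff (isHomogeneous_linSubst _ hF)]
      intro s hs
      by_cases hd : s.degree = d
      · obtain ⟨p, rfl⟩ := exists_jetExponent_eq hd hs
        exact congrFun (LinearMap.mem_ker.mp hk) p
      · exact (isHomogeneous_linSubst _ hF).coeff_eq_zero hd
    · rintro ⟨hF, ho⟩
      refine ⟨⟨F, hF⟩, ?_, rfl⟩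
      rw [← hA, ← ord_linSubst, le_ord_single_iff (isHomogeneous_linSubst _ hF)] at ho
      rw [LinearMap.mem_ker]
      ext ⟨⟨k, hk⟩, ⟨b, hb⟩⟩
      refine ho _ ?_
      show b + (k - b) < m
      simp only at hb
      omega
  have hrank := LinearMap.finrank_range_add_finrank_ker Λ
  rw [hsurj, finrank_top, Module.finrank_fintype_fun_eq_card] at hrank
  rw [← hker, Submodule.finrank_map_subtype_eq, ← hrank, ← two_mul_card_jet m]
  ring

theorem forms_inf_vanishing_eq_bot {d m : ℕ} (hm : d < m) (v : Fin 3 → ℂ) :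
    forms d ⊓ vanishing v m = ⊥ := by
  rw [eq_bot_iff]
  rintro F ⟨hF, ho⟩
  by_contra h0
  have := (mem_vanishing.mp ho).trans (ord_le_of_isHomogeneous hF h0 v)
  have : m ≤ d := by exact_mod_cast this
  omega

theorem two_mul_finrank_forms (d : ℕ) :
    2 * Module.finrank ℂ (forms d) = (d + 1) * (d + 2) := by
  have hv : (Pi.single 2 1 : Fin 3 → ℂ) ≠ 0 := by simp
  -- In the extreme case `m = d + 1` only the zero form is left, so the count of conditions is the
  -- dimension of all forms.
  have h := finrank_forms_inf_vanishing_of_le (d := d) (m := d + 1) le_rfl hv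
  rw [forms_inf_vanishing_eq_bot (Nat.lt_succ_self d), finrank_bot] at h
  linarith

theorem two_mul_finrank_forms_le {v : Fin 3 → ℂ} (hv : v ≠ 0) (d m : ℕ) :
    2 * Module.finrank ℂ (forms d) ≤
      2 * Module.finrank ℂ (forms d ⊓ vanishing v m : Submodule ℂ (MvPolynomial (Fin 3) ℂ))
        + m * (m + 1) := by
  rcases le_or_gt m (d + 1) with hm | hm
  · exact (finrank_forms_inf_vanishing_of_le hm hv).ge
  · rw [two_mul_finrank_forms]
    nlinarith

end Dimension

end BlownUpPlane

namespace BlownUpPlane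

open MvPolynomial

/-! ### Dimension counts in a vector space -/

section LinearAlgebra

variable {V : Type*} [AddCommGroup V] [Module ℂ V]

theorem finrank_map_mulLeft {F : MvPolynomial (Fin 3) ℂ} (hF : F ≠ 0)
    (P : Submodule ℂ (MvPolynomial (Fin 3) ℂ)) :
    Module.finrank ℂ (P.map (LinearMap.mulLeft ℂ F)) = Module.finrank ℂ P :=
  (Submodule.equivMapOfInjective _ (fun _ _ h => mul_left_cancel₀ hF h) P).finrank_eq.symm

theorem finrank_sup_add_le {P P' W : Submodule ℂ V} [FiniteDimensional ℂ P]
    [FiniteDimensional ℂ W] (h : P' ≤ P) (h' : P' ≤ W) :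
    Module.finrank ℂ (P ⊔ W : Submodule ℂ V) + Module.finrank ℂ P' ≤
      Module.finrank ℂ P + Module.finrank ℂ W := by
  rw [← Submodule.finrank_sup_add_finrank_inf_eq P W]
  have := Submodule.finiteDimensional_inf_left P W
  exact Nat.add_le_add_left (Submodule.finrank_mono (le_inf h h')) _

end LinearAlgebra

/-! ### Linear systems with several multiple points and Bézout's inequality -/

section Systems

variable {ι : Type*}

/-- Forms of degree `d` that vanish to order at least `m i` at `p i` for every `i ∈ s`. -/
noncomputable def system (p : ι → Fin 3 → ℂ) (m : ι → ℕ) (s : Finset ι) (d : ℕ) :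
    Submodule ℂ (MvPolynomial (Fin 3) ℂ) :=
  forms d ⊓ ⨅ i ∈ s, vanishing (p i) (m i)

variable {p : ι → Fin 3 → ℂ} {m m' : ι → ℕ} {s : Finset ι} {d e : ℕ}

theorem mem_system {F : MvPolynomial (Fin 3) ℂ} :
    F ∈ system p m s d ↔ F.IsHomogeneous d ∧ ∀ i ∈ s, (m i : ℕ∞) ≤ ord (p i) F := by
  simp [system, Submodule.mem_iInf, mem_vanishing]

theorem system_le_forms : system p m s d ≤ forms d := inf_le_left

instance : FiniteDimensional ℂ (system p m s d) :=
  Submodule.finiteDimensional_of_le system_le_forms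

theorem system_empty : system p m ∅ d = forms d := by simp [system]

theorem system_insert [DecidableEq ι] {i : ι} :
    system p m (insert i s) d = system p m s d ⊓ vanishing (p i) (m i) := by
  ext F
  simp only [Submodule.mem_inf, mem_system, mem_vanishing, Finset.forall_mem_insert]
  tauto

theorem mul_mem_system {F G : MvPolynomial (Fin 3) ℂ} (hF : F ∈ system p m s d)
    (hG : G ∈ system p m' s e) : F * G ∈ system p (m + m') s (d + e) := by
  rw [mem_system] at *
  refine ⟨hF.1.mul hG.1, fun i hi => ?_⟩
  rw [ord_mul, Pi.add_apply, Nat.cast_add]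
  exact add_le_add (hF.2 i hi) (hG.2 i hi)

theorem two_mul_finrank_forms_le_system (hp : ∀ i ∈ s, p i ≠ 0) (d : ℕ) :
    2 * Module.finrank ℂ (forms d) ≤
      2 * Module.finrank ℂ (system p m s d) + ∑ i ∈ s, m i * (m i + 1) := by
  classical
  induction s using Finset.induction_on with
  | empty => rw [system_empty]; simp
  | insert i s hi ih =>
    rw [Finset.forall_mem_insert] at hp
    have h1 := ih hp.2
    have h2 := two_mul_finrank_forms_le hp.1 d (m i)
    have h3 : system p m (insert i s) d = system p m s d ⊓ (forms d ⊓ vanishing (p i) (m i)) := by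
      rw [system_insert, ← inf_assoc, inf_eq_left.mpr system_le_forms]
    have := Submodule.finiteDimensional_inf_left (forms d) (vanishing (p i) (m i))
    have h4 := Submodule.finrank_sup_add_finrank_inf_eq (system p m s d)
      (forms d ⊓ vanishing (p i) (m i))
    have h5 := Submodule.finrank_mono
      (sup_le (system_le_forms (p := p) (m := m) (s := s) (d := d))
        (inf_le_left (b := vanishing (p i) (m i))))
    rw [Finset.sum_insert hi, h3]
    omega

theorem constantCoeff_taylor (v : Fin 3 → ℂ) (F : MvPolynomial (Fin 3) ℂ) :
    constantCoeff (taylor v F) = eval v F := by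
  have h : ((constantCoeff : MvPolynomial (Fin 3) ℂ →+* ℂ).comp (taylor v : _ →+* _))
      = eval v := by
    refine MvPolynomial.ringHom_ext (fun r => ?_) (fun j => ?_) <;> simp [taylor]
  exact DFunLike.congr_fun h F

theorem ord_eq_zero_of_eval_ne_zero {v : Fin 3 → ℂ} {F : MvPolynomial (Fin 3) ℂ}
    (h : eval v F ≠ 0) : ord v F = 0 := by
  by_contra h0
  have h1 : ((1 : ℕ) : ℕ∞) ≤ ord v F := by
    rw [Nat.cast_one]; exact Order.one_le_iff_pos.mpr (pos_iff_ne_zero.mpr h0)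
  rw [ord, le_order_coe_iff] at h1
  have h2 := h1 0 (by simp)
  rw [← constantCoeff_eq] at h2
  exact h ((constantCoeff_taylor v F).symm.trans h2)

theorem one_le_ord_of_eval_eq_zero {v : Fin 3 → ℂ} {F : MvPolynomial (Fin 3) ℂ}
    (h : eval v F = 0) : 1 ≤ ord v F := by
  rw [← Nat.cast_one, ord, le_order_coe_iff]
  intro t ht
  obtain rfl : t = 0 := by rw [← Finsupp.degree_eq_zero_iff]; omega
  rw [← constantCoeff_eq]
  exact (constantCoeff_taylor v F).trans h

theorem exists_linear_form {v w : Fin 3 → ℂ} (h : v ∉ Submodule.span ℂ {w}) :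
    ∃ ℓ : MvPolynomial (Fin 3) ℂ, ℓ.IsHomogeneous 1 ∧ eval w ℓ = 0 ∧ eval v ℓ ≠ 0 := by
  obtain ⟨f, hf, hfw⟩ := Submodule.exists_le_ker_of_notMem h
  have heval : ∀ u, eval u (∑ k, C (f (Pi.single k 1)) * X k) = f u := by
    intro u
    conv_rhs => rw [← Finset.univ_sum_single u]
    rw [map_sum, map_sum]
    refine Finset.sum_congr rfl fun k _ => ?_
    have : (Pi.single k (u k) : Fin 3 → ℂ) = u k • Pi.single k 1 := by
      rw [← Pi.single_smul]; simp
    rw [this, map_smul]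
    simp [mul_comm]
  refine ⟨∑ k, C (f (Pi.single k 1)) * X k,
    IsHomogeneous.sum _ _ _ fun k _ => isHomogeneous_C_mul_X _ _, ?_, ?_⟩
  · rw [heval]
    exact hfw (Submodule.mem_span_singleton_self w)
  · rwa [heval]

/-- Take the product of powers of lines, each through one `p i` and avoiding `v`. -/
theorem exists_separating_form {v : Fin 3 → ℂ} (hv : ∀ i ∈ s, v ∉ Submodule.span ℂ {p i}) :
    ∃ G ∈ system p m s (∑ i ∈ s, m i), ord v G = 0 := by
  classical
  have h : ∀ i : s, ∃ ℓ : MvPolynomial (Fin 3) ℂ,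
      ℓ.IsHomogeneous 1 ∧ eval (p i) ℓ = 0 ∧ eval v ℓ ≠ 0 := fun i =>
    exists_linear_form (hv i i.2)
  choose ℓ h1 h2 h3 using h
  refine ⟨∏ i : s, ℓ i ^ m i, mem_system.mpr ⟨?_, fun i hi => ?_⟩, ?_⟩
  · rw [← Finset.sum_coe_sort]
    refine IsHomogeneous.prod _ _ _ fun i _ => ?_
    simpa using (h1 i).pow (m i)
  · rw [← Finset.mul_prod_erase _ _ (Finset.mem_univ (⟨i, hi⟩ : s)), ord_mul, ord_pow]
    refine le_add_right ?_
    calc (m i : ℕ∞) = m i * 1 := (mul_one _).symm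
      _ ≤ _ := by gcongr; exact one_le_ord_of_eval_eq_zero (h2 ⟨i, hi⟩)
  · refine ord_eq_zero_of_eval_ne_zero ?_
    rw [map_prod]
    exact Finset.prod_ne_zero_iff.mpr fun i _ => by rw [map_pow]; exact pow_ne_zero _ (h3 i)

theorem ne_zero_of_ord_eq_zero {v : Fin 3 → ℂ} {G : MvPolynomial (Fin 3) ℂ} (h : ord v G = 0) :
    G ≠ 0 := by
  rintro rfl
  simp [ord] at h

/-- Vanishing conditions at distinct points are independent on forms of large degree. -/
theorem two_mul_finrank_system_le (hp : ∀ i ∈ s, p i ≠ 0)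
    (hpp : ∀ i ∈ s, ∀ j ∈ s, i ≠ j → p i ∉ Submodule.span ℂ {p j}) (hd : ∑ i ∈ s, m i ≤ d) :
    2 * Module.finrank ℂ (system p m s d) + ∑ i ∈ s, m i * (m i + 1) ≤
      2 * Module.finrank ℂ (forms d) := by
  classical
  induction s using Finset.induction_on with
  | empty => rw [system_empty]; simp
  | insert i s hi ih =>
    rw [Finset.forall_mem_insert] at hp
    rw [Finset.sum_insert hi] at hd ⊢
    have h1 := ih hp.2 (fun j hj k hk => hpp j (Finset.mem_insert_of_mem hj) k
      (Finset.mem_insert_of_mem hk)) (by omega)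
    obtain ⟨G, hG, hG0⟩ := exists_separating_form (p := p) (m := m) (s := s) (v := p i)
      fun j hj => hpp i (Finset.mem_insert_self i s) j (Finset.mem_insert_of_mem hj)
        (fun h => hi (h ▸ hj))
    have hGne := ne_zero_of_ord_eq_zero hG0
    -- Multiples of `G` by forms of degree `e ≥ m i` satisfy the old conditions, and since `G` does
    -- not vanish at `p i` they realize all jets there. The new conditions are therefore independent
    -- of the old ones.
    obtain ⟨e, rfl⟩ := Nat.exists_eq_add_of_le (show ∑ i ∈ s, m i ≤ d by omega)
    rw [system_insert]
    set g := ∑ i ∈ s, m i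
    have h2 := finrank_forms_inf_vanishing_of_le (show m i ≤ e + 1 by omega) hp.1
    set P := (forms e).map (LinearMap.mulLeft ℂ G)
    have hP : P ≤ system p m s (g + e) := by
      rintro _ ⟨F, hF, rfl⟩
      have hF' : F ∈ system p 0 s e := mem_system.mpr ⟨hF, by simp⟩
      simpa using mul_mem_system hG hF'
    have hinf : P ⊓ (system p m s (g + e) ⊓ vanishing (p i) (m i)) ≤
        (forms e ⊓ vanishing (p i) (m i)).map (LinearMap.mulLeft ℂ G) := by
      rintro _ ⟨⟨F, hF, rfl⟩, -, hv⟩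
      refine ⟨F, ⟨hF, ?_⟩, rfl⟩
      have : (m i : ℕ∞) ≤ ord (p i) (G * F) := hv
      rwa [ord_mul, hG0, zero_add] at this
    have := Submodule.finiteDimensional_inf_left (forms e) (vanishing (p i) (m i))
    have := Submodule.finiteDimensional_inf_left (system p m s (g + e)) (vanishing (p i) (m i))
    have h3 := Submodule.finrank_mono hinf
    have h4 := Submodule.finrank_sup_add_finrank_inf_eq P
      (system p m s (g + e) ⊓ vanishing (p i) (m i))
    have h5 := Submodule.finrank_mono (sup_le hP (inf_le_left (b := vanishing (p i) (m i))))
    have h6 : Module.finrank ℂ P = _ := finrank_map_mulLeft hGne (forms e)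
    have h7 := finrank_map_mulLeft hGne (forms e ⊓ vanishing (p i) (m i))
    omega

/-- Bézout's inequality for multiplicities. -/
theorem sum_mult_mul_mult_le [Fintype ι] {F G : MvPolynomial (Fin 3) ℂ} {a b : ℕ}
    (hp : ∀ i, p i ≠ 0) (hpp : ∀ i j, i ≠ j → p i ∉ Submodule.span ℂ {p j})
    (hF : F ∈ system p m Finset.univ a) (hG : G ∈ system p m' Finset.univ b)
    (hirr : Irreducible F) (hFG : ¬ F ∣ G) :
    ∑ i, m i * m' i ≤ a * b := by
  have hF0 := hirr.ne_zero
  have hG0 : G ≠ 0 := fun h => hFG (h ▸ dvd_zero F)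
  -- This degree makes the conditions defining `W` independent. The products `F · H` and `G · H` in
  -- `P'` and `Q'` lie in `W`, while those in `P` and `Q` overlap only in multiples of `F G`;
  -- comparing dimensions gives the inequality.
  set c := ∑ i, (m + m') i
  have hW := two_mul_finrank_system_le (p := p) (m := m + m') (s := Finset.univ) (d := a + b + c)
    (fun i _ => hp i) (fun i _ j _ => hpp i j) (by omega)
  set W := system p (m + m') Finset.univ (a + b + c)
  set P := (forms (b + c)).map (LinearMap.mulLeft ℂ F)
  set Q := (forms (a + c)).map (LinearMap.mulLeft ℂ G)
  set P' := (system p m' Finset.univ (b + c)).map (LinearMap.mulLeft ℂ F)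
  set Q' := (system p m Finset.univ (a + c)).map (LinearMap.mulLeft ℂ G)
  have hP'W : P' ≤ W := by
    rintro _ ⟨H, hH, rfl⟩
    have := mul_mem_system hF hH
    rwa [← add_assoc] at this
  have hQ'W : Q' ≤ W := by
    rintro _ ⟨H, hH, rfl⟩
    have := mul_mem_system hG hH
    rwa [← add_assoc, add_comm m' m, add_comm b a] at this
  have h1 : Module.finrank ℂ (P ⊔ W : Submodule ℂ _) + Module.finrank ℂ P' ≤
      Module.finrank ℂ P + Module.finrank ℂ W :=
    finrank_sup_add_le (Submodule.map_mono system_le_forms) hP'W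
  have h2 : Module.finrank ℂ (Q ⊔ (P ⊔ W) : Submodule ℂ _) + Module.finrank ℂ Q' ≤
      Module.finrank ℂ Q + Module.finrank ℂ (P ⊔ W : Submodule ℂ _) :=
    finrank_sup_add_le (Submodule.map_mono system_le_forms) (hQ'W.trans le_sup_right)
  have h3 : Module.finrank ℂ (Q ⊔ P : Submodule ℂ _) ≤
      Module.finrank ℂ (Q ⊔ (P ⊔ W) : Submodule ℂ _) :=
    Submodule.finrank_mono (sup_le_sup_left le_sup_left _)
  have hinf : Q ⊓ P ≤ (forms c).map (LinearMap.mulLeft ℂ (F * G)) := by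
    rintro _ ⟨⟨B, hB, rfl⟩, ⟨A, hA, hAB⟩⟩
    have hAB' : F * A = G * B := hAB
    by_cases hB0 : B = 0
    · subst hB0; simp
    obtain ⟨B', rfl⟩ : F ∣ B :=
      (hirr.prime.dvd_or_dvd (hAB' ▸ dvd_mul_right F A : F ∣ G * B)).resolve_left hFG
    have hB'0 : B' ≠ 0 := right_ne_zero_of_mul hB0
    have hB : (F * B').IsHomogeneous (a + c) := hB
    have hB' : B'.IsHomogeneous B'.totalDegree :=
      isHomogeneous_left_of_mul (mul_comm F B' ▸ hB) hB'0 hF0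
    have hdeg := (((mem_system.mp hF).1.mul hB').inj_right hB hB0)
    refine ⟨B', ?_, ?_⟩
    · show B'.IsHomogeneous c
      rwa [show c = B'.totalDegree by omega]
    · simp only [LinearMap.mulLeft_apply]
      ring
  have h4 := Submodule.finrank_sup_add_finrank_inf_eq Q P
  have h5 := Submodule.finrank_mono hinf
  have r1 : Module.finrank ℂ P = _ := finrank_map_mulLeft hF0 (forms (b + c))
  have r2 : Module.finrank ℂ Q = _ := finrank_map_mulLeft hG0 (forms (a + c))
  have r3 : Module.finrank ℂ P' = _ := finrank_map_mulLeft hF0 (system p m' Finset.univ (b + c))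
  have r4 : Module.finrank ℂ Q' = _ := finrank_map_mulLeft hG0 (system p m Finset.univ (a + c))
  have r5 := finrank_map_mulLeft (mul_ne_zero hF0 hG0) (forms c)
  have s1 := two_mul_finrank_forms_le_system (m := m') (s := Finset.univ) (fun i _ => hp i) (b + c)
  have s2 := two_mul_finrank_forms_le_system (m := m) (s := Finset.univ) (fun i _ => hp i) (a + c)
  have d1 := two_mul_finrank_forms (b + c)
  have d2 := two_mul_finrank_forms (a + c)
  have d3 := two_mul_finrank_forms c
  have d4 := two_mul_finrank_forms (a + b + c)
  have hsum : ∑ i, (m + m') i * ((m + m') i + 1) =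
      ∑ i, m i * (m i + 1) + ∑ i, m' i * (m' i + 1) + 2 * ∑ i, m i * m' i := by
    rw [Finset.mul_sum, ← Finset.sum_add_distrib, ← Finset.sum_add_distrib]
    exact Finset.sum_congr rfl fun i _ => by simp only [Pi.add_apply]; ring
  -- What remains is the second difference of `(d + 1)(d + 2) / 2` with steps `a` and `b`, which is
  -- `a b`.
  have key : 2 * ∑ i, m i * m' i + 2 * Module.finrank ℂ (forms (b + c)) +
      2 * Module.finrank ℂ (forms (a + c)) ≤
      2 * Module.finrank ℂ (forms (a + b + c)) + 2 * Module.finrank ℂ (forms c) := by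
    omega
  rw [d1, d2, d3, d4] at key
  nlinarith

end Systems

end BlownUpPlane

namespace BlownUpPlane

open MvPolynomial

variable {n : ℕ}

/-! ### Bilinearity of the intersection form -/

section IntersectionForm

theorem inter_comm (ξ η : N1 n) : inter ξ η = inter η ξ := by
  simp only [inter, mul_comm]

theorem inter_add_left (ξ η ζ : N1 n) : inter (ξ + η) ζ = inter ξ ζ + inter η ζ := by
  simp only [inter, Prod.fst_add, Prod.snd_add, Pi.add_apply, add_mul, Finset.sum_add_distrib]
  ring

theorem inter_smul_left (c : ℝ) (ξ η : N1 n) : inter (c • ξ) η = c * inter ξ η := by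
  simp only [inter, Prod.smul_fst, Prod.smul_snd, Pi.smul_apply, smul_eq_mul, mul_sub,
    Finset.mul_sum, mul_assoc]

theorem inter_add_right (ξ η ζ : N1 n) : inter ξ (η + ζ) = inter ξ η + inter ξ ζ := by
  rw [inter_comm, inter_add_left, inter_comm η, inter_comm ζ]

theorem inter_smul_right (c : ℝ) (ξ η : N1 n) : inter ξ (c • η) = c * inter ξ η := by
  rw [inter_comm, inter_smul_left, inter_comm]

theorem inter_sub_left (ξ η ζ : N1 n) : inter (ξ - η) ζ = inter ξ ζ - inter η ζ := by
  rw [sub_eq_add_neg, inter_add_left, ← neg_one_smul ℝ η, inter_smul_left]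
  ring

theorem inter_sub_right (ξ η ζ : N1 n) : inter ξ (η - ζ) = inter ξ η - inter ξ ζ := by
  rw [inter_comm, inter_sub_left, inter_comm η, inter_comm ζ]

theorem inter_zero_right (ξ : N1 n) : inter ξ 0 = 0 := by simp [inter]

theorem inter_sum_right {ι : Type*} (s : Finset ι) (ξ : N1 n) (f : ι → N1 n) :
    inter ξ (∑ i ∈ s, f i) = ∑ i ∈ s, inter ξ (f i) := by
  classical
  induction s using Finset.induction_on with
  | empty => simp [inter_zero_right]
  | insert i s hi ih => rw [Finset.sum_insert hi, Finset.sum_insert hi, inter_add_right, ih]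

theorem inter_sum_left {ι : Type*} (s : Finset ι) (ξ : N1 n) (f : ι → N1 n) :
    inter (∑ i ∈ s, f i) ξ = ∑ i ∈ s, inter (f i) ξ := by
  rw [inter_comm, inter_sum_right]
  exact Finset.sum_congr rfl fun i _ => inter_comm _ _

@[fun_prop]
theorem continuous_inter {T : Type*} [TopologicalSpace T] {f g : T → N1 n} (hf : Continuous f)
    (hg : Continuous g) : Continuous fun t => inter (f t) (g t) := by
  unfold inter
  fun_prop

theorem Pic.toN1_add (D D' : Pic n) : (D + D').toN1 = D.toN1 + D'.toN1 := by
  ext <;> simp [Pic.toN1]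

theorem Pic.toN1_sub (D D' : Pic n) : (D - D').toN1 = D.toN1 - D'.toN1 := by
  ext <;> simp [Pic.toN1]

theorem Pic.toN1_zero : (0 : Pic n).toN1 = 0 := by
  ext <;> simp [Pic.toN1]

theorem Pic.toN1_nsmul (k : ℕ) (D : Pic n) : (k • D).toN1 = (k : ℝ) • D.toN1 := by
  ext <;> simp [Pic.toN1]

theorem Pic.toN1_sum {ι : Type*} (s : Finset ι) (f : ι → Pic n) :
    Pic.toN1 (∑ i ∈ s, f i) = ∑ i ∈ s, (f i).toN1 := by
  classical
  induction s using Finset.induction_on with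
  | empty => simp [Pic.toN1_zero]
  | insert i s hi ih => rw [Finset.sum_insert hi, Finset.sum_insert hi, Pic.toN1_add, ih]

theorem Pic.toN1_injective : Function.Injective (Pic.toN1 (n := n)) := by
  intro D D' h
  have h1 : (D.1 : ℝ) = D'.1 := congrArg Prod.fst h
  have h2 := congrArg Prod.snd h
  ext i
  · exact_mod_cast h1
  · have := congrFun h2 i
    simpa [Pic.toN1] using this

end IntersectionForm

/-! ### Effective classes and Riemann–Roch -/

section Effective

variable {x : Fin n → Plane}

theorem isEffective_iff {D : Pic n} : IsEffective x D ↔ ∃ d : ℕ, (d : ℤ) = D.1 ∧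
    ∃ F ∈ system (fun i => (x i).rep) (fun i => (D.2 i).toNat) Finset.univ d, F ≠ 0 := by
  simp only [IsEffective, linearSystem, Set.mem_ofPred_eq, mem_system, vanishesToOrder_iff,
    Finset.mem_univ, true_implies]
  constructor
  · rintro ⟨F, ⟨⟨d, hd, hF⟩, ho⟩, h0⟩
    exact ⟨d, hd, F, ⟨hF, ho⟩, h0⟩
  · rintro ⟨d, hd, F, ⟨hF, ho⟩, h0⟩
    exact ⟨F, ⟨⟨d, hd, hF⟩, ho⟩, h0⟩

theorem IsEffective.of_form {D : Pic n} {F : MvPolynomial (Fin 3) ℂ} {d : ℕ}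
    (hF : F.IsHomogeneous d) (h0 : F ≠ 0) (hd : (d : ℤ) = D.1)
    (hm : ∀ i, D.2 i ≤ mult (x i).rep F) : IsEffective x D := by
  refine isEffective_iff.mpr ⟨d, hd, F, mem_system.mpr ⟨hF, fun i _ => ?_⟩, h0⟩
  rw [← coe_mult h0]
  have := hm i
  exact_mod_cast (by omega : (D.2 i).toNat ≤ mult (x i).rep F)

theorem IsEffective.exists_form {D : Pic n} (h : IsEffective x D) :
    ∃ (F : MvPolynomial (Fin 3) ℂ) (d : ℕ), F.IsHomogeneous d ∧ F ≠ 0 ∧ (d : ℤ) = D.1 ∧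
      ∀ i, D.2 i ≤ mult (x i).rep F := by
  obtain ⟨d, hd, F, hF, h0⟩ := isEffective_iff.mp h
  refine ⟨F, d, (mem_system.mp hF).1, h0, hd, fun i => ?_⟩
  have := (mem_system.mp hF).2 i (Finset.mem_univ i)
  rw [← coe_mult h0] at this
  have : (D.2 i).toNat ≤ mult (x i).rep F := by exact_mod_cast this
  omega

theorem IsEffective.add {D D' : Pic n} (h : IsEffective x D) (h' : IsEffective x D') :
    IsEffective x (D + D') := by
  obtain ⟨F, d, hF, h0, hd, hm⟩ := h.exists_form
  obtain ⟨F', d', hF', h0', hd', hm'⟩ := h'.exists_form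
  refine .of_form (hF.mul hF') (mul_ne_zero h0 h0') (by simp [hd, hd']) fun i => ?_
  rw [mult_mul h0 h0']
  push_cast
  exact add_le_add (hm i) (hm' i)

theorem isEffective_zero : IsEffective x 0 :=
  .of_form (isHomogeneous_one _ _) one_ne_zero rfl (by simp)

theorem IsEffective.nsmul {D : Pic n} (h : IsEffective x D) (k : ℕ) : IsEffective x (k • D) := by
  induction k with
  | zero => simpa using isEffective_zero
  | succ k ih => rw [succ_nsmul]; exact ih.add h

theorem IsEffective.sum {ι : Type*} (s : Finset ι) {f : ι → Pic n}
    (h : ∀ i ∈ s, IsEffective x (f i)) : IsEffective x (∑ i ∈ s, f i) := by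
  classical
  induction s using Finset.induction_on with
  | empty => simpa using isEffective_zero
  | insert i s hi ih =>
    rw [Finset.sum_insert hi]
    exact (h i (Finset.mem_insert_self i s)).add
      (ih fun j hj => h j (Finset.mem_insert_of_mem hj))

theorem mult_le_of_isHomogeneous {F : MvPolynomial (Fin 3) ℂ} {d : ℕ} (hF : F.IsHomogeneous d)
    (h0 : F ≠ 0) (v : Fin 3 → ℂ) : mult v F ≤ d := by
  have := ord_le_of_isHomogeneous hF h0 v
  rw [← coe_mult h0] at this
  exact_mod_cast this

theorem IsEffective.degree_nonneg {D : Pic n} (h : IsEffective x D) : 0 ≤ D.1 := by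
  obtain ⟨F, d, hF, h0, hd, hm⟩ := h.exists_form
  omega

theorem IsEffective.le_degree {D : Pic n} (h : IsEffective x D) (i : Fin n) : D.2 i ≤ D.1 := by
  obtain ⟨F, d, hF, h0, hd, hm⟩ := h.exists_form
  have h1 := mult_le_of_isHomogeneous hF h0 (x i).rep
  have h2 := hm i
  omega

/-- Riemann–Roch: a class `D` with `D · L ≥ 0` and `D² ≥ D · K` is effective. -/
theorem isEffective_of_canonical_le {D : Pic n} (h0 : 0 ≤ D.1)
    (h : inter D.toN1 (canonicalClass n) ≤ inter D.toN1 D.toN1) : IsEffective x D := by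
  obtain ⟨d, hd⟩ := Int.eq_ofNat_of_zero_le h0
  refine isEffective_iff.mpr ⟨d, hd.symm, ?_⟩
  have h1 := two_mul_finrank_forms_le_system (p := fun i => (x i).rep)
    (m := fun i => (D.2 i).toNat) (s := Finset.univ) (fun i _ => (x i).rep_nonzero) d
  rw [two_mul_finrank_forms] at h1
  -- The right side is `(d + 1)(d + 2) - 2`, so the conditions leave a space of positive dimension.
  have h2 : ∑ i, D.2 i * (D.2 i + 1) ≤ (d : ℤ) * (d + 3) := by
    simp only [inter, canonicalClass, Pic.toN1, hd, mul_neg, mul_one, Finset.sum_neg_distrib] at h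
    have : ∑ i, (D.2 i : ℝ) * (D.2 i + 1) ≤ (d : ℝ) * (d + 3) := by
      simp only [mul_add, mul_one, Finset.sum_add_distrib]
      push_cast at h
      linarith
    exact_mod_cast this
  -- Negative multiplicities impose no condition, and `m (m + 1) ≥ 0` for every negative integer
  -- `m`.
  have h3 : ((∑ i, (D.2 i).toNat * ((D.2 i).toNat + 1) : ℕ) : ℤ) ≤ ∑ i, D.2 i * (D.2 i + 1) := by
    push_cast
    refine Finset.sum_le_sum fun i _ => ?_
    rcases le_or_gt 0 (D.2 i) with hi | hi
    · rw [Int.toNat_of_nonneg hi]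
    · rw [Int.toNat_of_nonpos hi.le]
      push_cast
      nlinarith
  have h4 : ∑ i, (D.2 i).toNat * ((D.2 i).toNat + 1) ≤ d * (d + 3) := by
    exact_mod_cast h3.trans h2
  have h5 : system (fun i => (x i).rep) (fun i => (D.2 i).toNat) Finset.univ d ≠ ⊥ := by
    intro hbot
    rw [hbot, finrank_bot] at h1
    nlinarith
  obtain ⟨F, hF, hF0⟩ := Submodule.exists_mem_ne_zero_of_ne_bot h5
  exact ⟨F, hF, hF0⟩

end Effective

/-! ### Irreducible curves -/

section Curves

variable {x : Fin n → Plane}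

/-- The class of the strict transform of the plane curve `F = 0`. -/
noncomputable def formClass (x : Fin n → Plane) (F : MvPolynomial (Fin 3) ℂ) : Pic n :=
  (F.totalDegree, fun i => mult (x i).rep F)

/-- The class of the exceptional curve over the `i`-th point. -/
def exceptional (i : Fin n) : Pic n := (0, -Pi.single i 1)

/-- Classes of irreducible curves: strict transforms of irreducible plane curves and exceptional
curves. -/
def IsCurve (x : Fin n → Plane) (C : Pic n) : Prop :=
  (∃ F, Irreducible F ∧ F.IsHomogeneous F.totalDegree ∧ C = formClass x F) ∨
    ∃ i, C = exceptional i

theorem formClass_mul {F G : MvPolynomial (Fin 3) ℂ} (hF : F ≠ 0) (hG : G ≠ 0) :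
    formClass x (F * G) = formClass x F + formClass x G := by
  ext i
  · simp [formClass, totalDegree_mul_of_isDomain hF hG]
  · simp [formClass, mult_mul hF hG]

theorem formClass_pow {F : MvPolynomial (Fin 3) ℂ} (hF : F ≠ 0) (k : ℕ) :
    formClass x (F ^ k) = k • formClass x F := by
  induction k with
  | zero => ext i <;> simp [formClass, mult, ord_one]
  | succ k ih => rw [pow_succ, formClass_mul (pow_ne_zero _ hF) hF, ih, succ_nsmul]

theorem formClass_unit {u : MvPolynomial (Fin 3) ℂ} (hu : IsUnit u) : formClass x u = 0 := by
  obtain ⟨w, hw⟩ := hu.exists_right_inv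
  have hu0 := hu.ne_zero
  have hw0 : w ≠ 0 := right_ne_zero_of_mul (hw ▸ one_ne_zero)
  have h := formClass_mul (x := x) hu0 hw0
  rw [hw, ← pow_zero u, formClass_pow hu0, zero_nsmul] at h
  have h1 := congrArg Prod.fst h
  have h2 := congrArg Prod.snd h
  ext i
  · simp only [formClass, Prod.fst_zero, Prod.fst_add] at h1 ⊢
    omega
  · have := congrFun h2 i
    simp only [formClass, Prod.snd_zero, Prod.snd_add, Pi.zero_apply, Pi.add_apply] at this ⊢
    omega

theorem inter_exceptional (ξ : N1 n) (i : Fin n) : inter ξ (exceptional i).toN1 = ξ.2 i := by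
  simp [inter, exceptional, Pic.toN1, Pi.single_apply]

theorem isEffective_formClass {F : MvPolynomial (Fin 3) ℂ} (hF : F ≠ 0)
    (hom : F.IsHomogeneous F.totalDegree) : IsEffective x (formClass x F) :=
  .of_form hom hF rfl fun _ => le_rfl

theorem isEffective_exceptional (i : Fin n) : IsEffective x (exceptional i) :=
  .of_form (isHomogeneous_one _ _) one_ne_zero rfl fun j => by
    simp only [exceptional, Pi.neg_apply, Pi.single_apply]
    split_ifs <;> omega

theorem IsCurve.isEffective {C : Pic n} (h : IsCurve x C) : IsEffective x C := by
  rcases h with ⟨F, hF, hom, rfl⟩ | ⟨i, rfl⟩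
  · exact isEffective_formClass hF.ne_zero hom
  · exact isEffective_exceptional i

theorem IsCurve.ne_zero {C : Pic n} (h : IsCurve x C) : C ≠ 0 := by
  rcases h with ⟨F, hF, hom, rfl⟩ | ⟨i, rfl⟩
  · intro h0
    have h1 : (F.totalDegree : ℤ) = 0 := congrArg Prod.fst h0
    have h2 : F.totalDegree = 0 := by exact_mod_cast h1
    rw [totalDegree_eq_zero_iff_eq_C] at h2
    apply hF.not_isUnit
    rw [h2, isUnit_iff_eq_C_of_isReduced]
    refine ⟨_, ?_, rfl⟩
    rw [isUnit_iff_ne_zero]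
    intro hc
    rw [hc, C_0] at h2
    exact hF.ne_zero h2
  · intro h0
    have := congrFun (congrArg Prod.snd h0) i
    simp [exceptional] at this

/-- A class that is nonnegative on irreducible curves is nef. -/
theorem mem_nefCone_of_forall_isCurve {ξ : N1 n} (h : ∀ C, IsCurve x C → 0 ≤ inter ξ C.toN1) :
    ξ ∈ nefCone x := by
  have hform : ∀ F : MvPolynomial (Fin 3) ℂ, F ≠ 0 → F.IsHomogeneous F.totalDegree →
      0 ≤ inter ξ (formClass x F).toN1 := by
    intro F
    induction F using WfDvdMonoid.induction_on_irreducible with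
    | zero => intro h0; exact absurd rfl h0
    | unit u hu =>
      intro _ _
      rw [formClass_unit hu, Pic.toN1_zero, inter_zero_right]
    | mul a i ha hi ih =>
      intro h0 hom
      have ha' := isHomogeneous_left_of_mul (mul_comm i a ▸ hom) ha hi.ne_zero
      have hi' := isHomogeneous_left_of_mul hom hi.ne_zero ha
      rw [formClass_mul hi.ne_zero ha, Pic.toN1_add, inter_add_right]
      exact add_nonneg (h _ (Or.inl ⟨i, hi, hi', rfl⟩)) (ih ha ha')
  intro D hD
  obtain ⟨F, d, hF, h0, hd, hm⟩ := hD.exists_form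
  have hdeg := hF.totalDegree h0
  -- An effective class is the strict transform of a form plus exceptional curves, counted by the
  -- excess of the actual over the prescribed multiplicities.
  have hD' : D.toN1 = (formClass x F).toN1 +
      ∑ i, ((mult (x i).rep F : ℝ) - D.2 i) • (exceptional i).toN1 := by
    ext j
    · simp [Pic.toN1, formClass, exceptional, hdeg, ← hd, Prod.fst_sum]
    · simp [Pic.toN1, formClass, exceptional, Prod.snd_sum, Finset.sum_apply, Pi.single_apply]
  rw [hD', inter_add_right, inter_sum_right]
  refine add_nonneg (hform F h0 (hdeg ▸ hF)) (Finset.sum_nonneg fun i _ => ?_)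
  rw [inter_smul_right]
  refine mul_nonneg ?_ (h _ (Or.inr ⟨i, rfl⟩))
  have : (D.2 i : ℝ) ≤ (mult (x i).rep F : ℝ) := by exact_mod_cast hm i
  linarith

theorem rep_notMem_span (hx : Function.Injective x) {i j : Fin n} (hij : i ≠ j) :
    (x i).rep ∉ Submodule.span ℂ {(x j).rep} := by
  intro h
  obtain ⟨a, ha⟩ := Submodule.mem_span_singleton.mp h
  apply hij
  apply hx
  rw [← (x i).mk_rep, ← (x j).mk_rep, Projectivization.mk_eq_mk_iff']
  exact ⟨a, ha⟩

theorem inter_formClass_nonneg (hx : Function.Injective x) {F G : MvPolynomial (Fin 3) ℂ}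
    (hF : Irreducible F) (hFh : F.IsHomogeneous F.totalDegree) (hG : G ≠ 0)
    (hGh : G.IsHomogeneous G.totalDegree) (hFG : ¬ F ∣ G) :
    0 ≤ inter (formClass x F).toN1 (formClass x G).toN1 := by
  have h := sum_mult_mul_mult_le (p := fun i => (x i).rep) (m := fun i => mult (x i).rep F)
    (m' := fun i => mult (x i).rep G) (F := F) (G := G) (fun i => (x i).rep_nonzero)
    (fun i j hij => rep_notMem_span hx hij)
    (mem_system.mpr ⟨hFh, fun i _ => (coe_mult hF.ne_zero _).le⟩)
    (mem_system.mpr ⟨hGh, fun i _ => (coe_mult hG _).le⟩) hF hFG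
  simp only [inter, formClass, Pic.toN1, Int.cast_natCast]
  rw [sub_nonneg]
  exact_mod_cast h

/-- Distinct irreducible curves meet nonnegatively. -/
theorem IsCurve.inter_nonneg (hx : Function.Injective x) {C C' : Pic n} (h : IsCurve x C)
    (h' : IsCurve x C') (hne : C ≠ C') : 0 ≤ inter C.toN1 C'.toN1 := by
  rcases h with ⟨F, hF, hom, rfl⟩ | ⟨i, rfl⟩
  · rcases h' with ⟨G, hG, hom', rfl⟩ | ⟨j, rfl⟩
    · refine inter_formClass_nonneg hx hF hom hG.ne_zero hom' fun hdvd => hne ?_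
      obtain ⟨u, rfl⟩ := hF.associated_of_dvd hG hdvd
      rw [formClass_mul hF.ne_zero u.ne_zero, formClass_unit u.isUnit, add_zero]
    · rw [inter_exceptional]
      simp [Pic.toN1, formClass]
  · rw [inter_comm, inter_exceptional]
    rcases h' with ⟨G, hG, hom', rfl⟩ | ⟨j, rfl⟩
    · simp [Pic.toN1, formClass]
    · have hij : i ≠ j := fun h => hne (h ▸ rfl)
      simp [Pic.toN1, exceptional, Pi.single_apply, hij]

/-- An irreducible curve can be split off an effective class until the intersection number of the
two is nonnegative. -/
theorem IsCurve.exists_isEffective_sub (hx : Function.Injective x) {C D : Pic n}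
    (h : IsCurve x C) (hD : IsEffective x D) :
    ∃ k : ℕ, IsEffective x (D - k • C) ∧ 0 ≤ inter C.toN1 (D - k • C).toN1 := by
  obtain ⟨H, d, hH, h0, hd, hm⟩ := hD.exists_form
  rcases h with ⟨F, hF, hom, rfl⟩ | ⟨i, rfl⟩
  · obtain ⟨k, G, rfl, hFG⟩ : ∃ (k : ℕ) (G : _), H = F ^ k * G ∧ ¬ F ∣ G :=
      ⟨_, (FiniteMultiplicity.of_not_isUnit hF.not_isUnit h0).exists_eq_pow_mul_and_not_dvd⟩
    have hF0 := hF.ne_zero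
    have hG0 : G ≠ 0 := right_ne_zero_of_mul h0
    have hG := isHomogeneous_left_of_mul (mul_comm _ G ▸ hH) hG0 (pow_ne_zero _ hF0)
    have hcls : formClass x (F ^ k * G) = k • formClass x F + formClass x G := by
      rw [formClass_mul (pow_ne_zero _ hF0) hG0, formClass_pow hF0]
    have hdeg : (D - k • formClass x F).1 = G.totalDegree := by
      have h1 := congrArg Prod.fst hcls
      have h2 := hH.totalDegree h0
      simp only [formClass, Prod.fst_add, Prod.fst_sub] at h1 ⊢
      omega
    have hmul : ∀ i, (D - k • formClass x F).2 i ≤ mult (x i).rep G := by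
      intro i
      have h1 := congrFun (congrArg Prod.snd hcls) i
      have h2 := hm i
      simp only [formClass, Prod.snd_add, Prod.snd_sub, Pi.add_apply, Pi.sub_apply] at h1 ⊢
      omega
    refine ⟨k, .of_form hG hG0 hdeg.symm hmul, ?_⟩
    -- Bézout applies to the actual multiplicities of `G`; those prescribed by the class are no
    -- larger, so its intersection with the curve can only be larger.
    refine (inter_formClass_nonneg hx hF hom hG0 hG hFG).trans ?_
    generalize D - k • formClass x F = D' at hdeg hmul ⊢
    simp only [inter, Pic.toN1, hdeg]
    refine sub_le_sub_left (Finset.sum_le_sum fun i _ => ?_) _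
    have h1 : (D'.2 i : ℝ) ≤ mult (x i).rep G := by exact_mod_cast hmul i
    exact mul_le_mul_of_nonneg_left h1 (by simp [formClass])
  · have hk : ∀ (k : ℕ) (j : Fin n),
        (D - k • exceptional i).2 j = D.2 j + if j = i then (k : ℤ) else 0 := by
      intro k j
      simp [exceptional, Pi.single_apply]
    -- Subtracting this multiple of the exceptional curve raises a negative `D.2 i` to `0`, which
    -- still imposes no condition.
    refine ⟨(-D.2 i).toNat, .of_form hH h0 (by simp [hd, exceptional]) fun j => ?_, ?_⟩
    · have := hm j
      rw [hk]
      split_ifs with hji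
      · subst hji
        omega
      · simpa using this
    · rw [inter_comm, inter_exceptional]
      simp only [Pic.toN1]
      rw [hk, if_pos rfl]
      exact_mod_cast (by omega : 0 ≤ D.2 i + ((-D.2 i).toNat : ℤ))

end Curves

end BlownUpPlane

namespace BlownUpPlane

variable {n : ℕ}

/-! ### The Mori cone and the nef cone -/

section Cones

variable {x : Fin n → Plane}

theorem inter_lineClass (ξ : N1 n) : inter ξ (lineClass n) = ξ.1 := by
  simp [inter, lineClass]

theorem exists_nsmul_isEffective {D : Pic n} (h0 : 0 < D.1) (h : 0 < inter D.toN1 D.toN1) :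
    ∃ k : ℕ, 0 < k ∧ IsEffective x (k • D) := by
  obtain ⟨k, hk⟩ := exists_nat_ge (inter D.toN1 (canonicalClass n) / inter D.toN1 D.toN1)
  rw [div_le_iff₀ h] at hk
  refine ⟨k + 1, Nat.succ_pos k, isEffective_of_canonical_le (nsmul_nonneg h0.le _) ?_⟩
  rw [Pic.toN1_nsmul, inter_smul_left, inter_smul_left, inter_smul_right]
  refine mul_le_mul_of_nonneg_left ?_ (by positivity)
  push_cast
  nlinarith

theorem isClosed_moriCone : IsClosed (moriCone x) := isClosed_closure

/-- The class of a line, as an element of the Picard group. -/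
def linePic (n : ℕ) : Pic n := (1, 0)

theorem isEffective_linePic : IsEffective x (linePic n) :=
  .of_form (MvPolynomial.isHomogeneous_X ℂ 0) (MvPolynomial.X_ne_zero 0) rfl (by simp [linePic])

theorem toN1_linePic : (linePic n).toN1 = lineClass n := by
  ext <;> simp [linePic, lineClass, Pic.toN1]

theorem smul_toN1_mem_moriCone_of_ne_zero {D : Pic n} (hD : IsEffective x D) (h0 : D ≠ 0) {c : ℝ}
    (hc : 0 < c) : c • D.toN1 ∈ moriCone x :=
  subset_closure ⟨ray D.toN1, ⟨D, h0, hD, rfl⟩, c, hc, rfl⟩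

theorem zero_mem_moriCone : (0 : N1 n) ∈ moriCone x := by
  have h : Filter.Tendsto (fun k : ℕ => (1 / ((k : ℝ) + 1)) • (linePic n).toN1) Filter.atTop
      (nhds ((0 : ℝ) • (linePic n).toN1)) :=
    tendsto_one_div_add_atTop_nhds_zero_nat.smul_const _
  rw [zero_smul] at h
  refine isClosed_moriCone.mem_of_tendsto h (Filter.Eventually.of_forall fun k => ?_)
  refine smul_toN1_mem_moriCone_of_ne_zero isEffective_linePic (fun h => ?_) (by positivity)
  simpa [linePic] using congrArg Prod.fst h

theorem smul_toN1_mem_moriCone {D : Pic n} (hD : IsEffective x D) {c : ℝ} (hc : 0 ≤ c) :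
    c • D.toN1 ∈ moriCone x := by
  rcases hc.eq_or_lt with rfl | hc
  · rw [zero_smul]; exact zero_mem_moriCone
  by_cases h0 : D = 0
  · rw [h0, Pic.toN1_zero, smul_zero]; exact zero_mem_moriCone
  · exact smul_toN1_mem_moriCone_of_ne_zero hD h0 hc

/-- Real combinations of two effective rays need not be rational; they are limits of the effective
classes `⌈c t⌉ D + ⌈c' t⌉ D'` divided by `t`. -/
theorem add_mem_moriCone {α β : N1 n} (hα : α ∈ moriCone x) (hβ : β ∈ moriCone x) :
    α + β ∈ moriCone x := by
  refine isClosed_moriCone.closure_subset (map_mem_closure₂ continuous_add hα hβ ?_)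
  rintro _ ⟨_, ⟨D, -, hD, rfl⟩, c, hc, rfl⟩ _ ⟨_, ⟨D', -, hD', rfl⟩, c', hc', rfl⟩
  have h := ((tendsto_nat_ceil_mul_div_atTop hc.le).smul_const D.toN1).add
    ((tendsto_nat_ceil_mul_div_atTop hc'.le).smul_const D'.toN1)
  refine isClosed_moriCone.mem_of_tendsto h ?_
  filter_upwards [Filter.eventually_gt_atTop (0 : ℝ)] with t ht
  have := smul_toN1_mem_moriCone ((hD.nsmul ⌈c * t⌉₊).add (hD'.nsmul ⌈c' * t⌉₊))
    (inv_nonneg.mpr ht.le)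
  rw [Pic.toN1_add, Pic.toN1_nsmul, Pic.toN1_nsmul, smul_add, smul_smul, smul_smul] at this
  rwa [div_eq_inv_mul, div_eq_inv_mul]

theorem inter_nonneg_of_mem_nefCone {η α : N1 n} (hη : η ∈ nefCone x) (hα : α ∈ moriCone x) :
    0 ≤ inter η α := by
  have hcl : IsClosed {α : N1 n | 0 ≤ inter η α} :=
    isClosed_le continuous_const (by fun_prop)
  refine closure_minimal ?_ hcl hα
  rintro _ ⟨_, ⟨D, -, hD, rfl⟩, t, ht, rfl⟩
  show 0 ≤ inter η (t • D.toN1)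
  rw [inter_smul_right]
  exact mul_nonneg ht.le (hη D hD)

theorem lineClass_mem_nefCone : lineClass n ∈ nefCone x := by
  intro D hD
  rw [inter_comm, inter_lineClass]
  have := hD.degree_nonneg
  simpa [Pic.toN1] using this

theorem fst_nonneg_of_mem_moriCone {α : N1 n} (hα : α ∈ moriCone x) : 0 ≤ α.1 := by
  rw [← inter_lineClass, inter_comm]
  exact inter_nonneg_of_mem_nefCone lineClass_mem_nefCone hα

/-- The class `(n + 1) L - ∑ i, E i`, which is positive on nonzero effective classes. -/
def ampleClass (n : ℕ) : N1 n := (n + 1, fun _ => 1)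

theorem inter_ampleClass_pos {D : Pic n} (hD : IsEffective x D) (h0 : D ≠ 0) :
    0 < inter (ampleClass n) D.toN1 := by
  have hkey : 0 < ((n : ℤ) + 1) * D.1 - ∑ i, D.2 i := by
    have hsum : ∑ i, D.2 i ≤ ∑ _i : Fin n, D.1 := Finset.sum_le_sum fun i _ => hD.le_degree i
    rw [Finset.sum_const, Finset.card_univ, Fintype.card_fin, nsmul_eq_mul] at hsum
    rcases hD.degree_nonneg.eq_or_lt with hd | hd
    · by_contra hle
      have hnonpos : ∀ i ∈ Finset.univ, D.2 i ≤ 0 := fun i _ => hd ▸ hD.le_degree i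
      have hz : ∑ i, D.2 i = 0 := by
        rw [← hd] at hsum hle
        linarith
      apply h0
      ext i
      · exact hd.symm
      · exact (Finset.sum_eq_zero_iff_of_nonpos hnonpos).mp hz i (Finset.mem_univ i)
    · nlinarith
  simp only [inter, ampleClass, Pic.toN1, one_mul]
  exact_mod_cast hkey

theorem ampleClass_mem_nefCone : ampleClass n ∈ nefCone x := by
  intro D hD
  by_cases h0 : D = 0
  · rw [h0, Pic.toN1_zero, inter_zero_right]
  · exact (inter_ampleClass_pos hD h0).le

/-- The coefficient makes the remainder orthogonal to `C`. For an effective class,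
`exists_isEffective_sub` removes at least this multiple of `C`, and the surplus is added back; the
general case follows by continuity. -/
theorem IsCurve.sub_smul_mem_moriCone (hx : Function.Injective x) {C : Pic n} (hC : IsCurve x C)
    {α : N1 n} (hα : α ∈ moriCone x) (h : inter α C.toN1 < 0) :
    inter C.toN1 C.toN1 < 0 ∧
      α - (inter α C.toN1 / inter C.toN1 C.toN1) • C.toN1 ∈ moriCone x := by
  have key : ∀ β ∈ ⋃₀ {ρ | IsEffectiveRay x ρ}, inter β C.toN1 < 0 →
      inter C.toN1 C.toN1 < 0 ∧
        β - (inter β C.toN1 / inter C.toN1 C.toN1) • C.toN1 ∈ moriCone x := by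
    rintro _ ⟨_, ⟨D, -, hD, rfl⟩, c, hc, rfl⟩ hneg
    rw [inter_smul_left] at hneg ⊢
    have hneg' : inter D.toN1 C.toN1 < 0 := by
      by_contra hge
      exact absurd hneg (not_lt.mpr (mul_nonneg hc.le (not_lt.mp hge)))
    obtain ⟨k, hk, hk'⟩ := hC.exists_isEffective_sub hx hD
    rw [Pic.toN1_sub, Pic.toN1_nsmul, inter_sub_right, inter_smul_right, inter_comm C.toN1 D.toN1]
      at hk'
    have hkC : (k : ℝ) * inter C.toN1 C.toN1 < 0 := by linarith
    have hCC : inter C.toN1 C.toN1 < 0 := by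
      by_contra hge
      exact absurd hkC (not_lt.mpr (mul_nonneg k.cast_nonneg (not_lt.mp hge)))
    refine ⟨hCC, ?_⟩
    have hle : inter D.toN1 C.toN1 / inter C.toN1 C.toN1 ≤ k := by
      rw [div_le_iff_of_neg hCC]; linarith
    have h1 := smul_toN1_mem_moriCone hk hc.le
    have h2 := smul_toN1_mem_moriCone hC.isEffective
      (mul_nonneg hc.le (sub_nonneg.mpr hle))
    have h3 := add_mem_moriCone h1 h2
    convert h3 using 1
    rw [Pic.toN1_sub, Pic.toN1_nsmul, mul_div_assoc]
    module
  obtain ⟨u, hu, hlim⟩ := mem_closure_iff_seq_limit.mp hα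
  have hlim' : Filter.Tendsto (fun k => inter (u k) C.toN1) Filter.atTop
      (nhds (inter α C.toN1)) :=
    ((continuous_inter continuous_id continuous_const).tendsto α).comp hlim
  have hev := hlim'.eventually_lt_const h
  obtain ⟨k, hk⟩ := hev.exists
  refine ⟨(key _ (hu k) hk).1, ?_⟩
  refine isClosed_moriCone.mem_of_tendsto
    (hlim.sub ((hlim'.div_const (inter C.toN1 C.toN1)).smul_const C.toN1)) ?_
  filter_upwards [hev] with k hk using (key _ (hu k) hk).2

end Cones

/-! ### The nonnegative cone and the signature of the form -/

section NonnegCone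

variable {x : Fin n → Plane}

theorem IsRational.exists_toN1_eq {ξ : N1 n} (h : IsRational ξ) :
    ∃ (N : ℕ) (D : Pic n), 0 < N ∧ D.toN1 = (N : ℝ) • ξ := by
  obtain ⟨⟨q, hq⟩, h2⟩ := h
  choose r hr using h2
  have hint : ∀ (t : ℚ) (N : ℕ), t.den ∣ N → ∃ z : ℤ, (z : ℝ) = N * t := by
    rintro t _ ⟨k, rfl⟩
    refine ⟨k * t.num, ?_⟩
    have hmul : (t : ℝ) * t.den = t.num := by exact_mod_cast t.mul_den_eq_num
    push_cast
    rw [← hmul]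
    ring
  set N := q.den * ∏ i, (r i).den
  obtain ⟨d, hd⟩ := hint q N (dvd_mul_right _ _)
  have hm : ∀ i, ∃ z : ℤ, (z : ℝ) = N * r i := fun i =>
    hint (r i) N ((Finset.dvd_prod_of_mem _ (Finset.mem_univ i)).mul_left _)
  choose m hm using hm
  refine ⟨N, (d, m), Nat.mul_pos q.den_pos (Finset.prod_pos fun i _ => (r i).den_pos), ?_⟩
  ext i
  · simp [Pic.toN1, hd, hq]
  · simp [Pic.toN1, hm, hr]

theorem mem_moriCone_of_isRational {ξ : N1 n} (hξ : IsRational ξ) (h1 : 0 < ξ.1)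
    (h2 : 0 < inter ξ ξ) : ξ ∈ moriCone x := by
  obtain ⟨N, D, hN, hD⟩ := hξ.exists_toN1_eq
  have hN' : (0 : ℝ) < N := by exact_mod_cast hN
  have hd : 0 < D.1 := by
    have : (D.1 : ℝ) = N * ξ.1 := congrArg Prod.fst hD
    have : (0 : ℝ) < D.1 := by rw [this]; positivity
    exact_mod_cast this
  have hDD : 0 < inter D.toN1 D.toN1 := by
    rw [hD, inter_smul_left, inter_smul_right]; positivity
  obtain ⟨k, hk, hkD⟩ := exists_nsmul_isEffective (x := x) hd hDD
  have hk' : (0 : ℝ) < k := by exact_mod_cast hk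
  have := smul_toN1_mem_moriCone hkD (c := ((k : ℝ) * N)⁻¹) (by positivity)
  rwa [Pic.toN1_nsmul, hD, smul_smul, smul_smul, mul_assoc, inv_mul_cancel₀ (by positivity),
    one_smul] at this

theorem isOpen_positiveCone : IsOpen {ξ : N1 n | 0 < ξ.1 ∧ 0 < inter ξ ξ} :=
  IsOpen.and (isOpen_lt continuous_const continuous_fst)
    (isOpen_lt continuous_const (continuous_inter continuous_id continuous_id))

theorem isClosed_nonnegCone : IsClosed (nonnegCone n) :=
  IsClosed.and (isClosed_le continuous_const (continuous_inter continuous_id continuous_const))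
    (isClosed_le continuous_const (continuous_inter continuous_id continuous_id))

/-- Rational classes of positive square and degree have effective multiples and are dense in the
open cone; a point of `Q` is the limit of its translates by small multiples of `L`, which lie in
that open cone. -/
theorem nonnegCone_subset_moriCone : nonnegCone n ⊆ moriCone x := by
  have hdense : Dense {ξ : N1 n | IsRational ξ} := by
    have h : DenseRange (Prod.map ((↑) : ℚ → ℝ) (Pi.map fun _ : Fin n => ((↑) : ℚ → ℝ))) :=
      Rat.denseRange_cast.prodMap (DenseRange.piMap fun _ => Rat.denseRange_cast)
    refine h.mono ?_
    rintro _ ⟨q, rfl⟩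
    exact ⟨⟨q.1, rfl⟩, fun i => ⟨q.2 i, rfl⟩⟩
  have hint : {ξ : N1 n | 0 < ξ.1 ∧ 0 < inter ξ ξ} ⊆ moriCone x := by
    refine (hdense.open_subset_closure_inter isOpen_positiveCone).trans (closure_minimal ?_ isClosed_moriCone)
    rintro ξ ⟨⟨h1, h2⟩, hr⟩
    exact mem_moriCone_of_isRational hr h1 h2
  rintro ξ ⟨h1, h2⟩
  rw [inter_lineClass] at h1
  have hlim : Filter.Tendsto (fun k : ℕ => ξ + (1 / ((k : ℝ) + 1)) • lineClass n) Filter.atTop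
      (nhds (ξ + (0 : ℝ) • lineClass n)) :=
    (tendsto_one_div_add_atTop_nhds_zero_nat.smul_const _).const_add ξ
  rw [zero_smul, add_zero] at hlim
  refine isClosed_moriCone.mem_of_tendsto hlim (Filter.Eventually.of_forall fun k => hint ?_)
  have hpos : (0 : ℝ) < 1 / ((k : ℝ) + 1) := by positivity
  set ε := 1 / ((k : ℝ) + 1)
  have hLL : inter (lineClass n) (lineClass n) = 1 := by rw [inter_lineClass]; rfl
  refine ⟨?_, ?_⟩
  · show 0 < ξ.1 + ε * 1
    linarith
  · rw [inter_add_left, inter_add_right, inter_add_right, inter_smul_left, inter_smul_left,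
      inter_smul_right, inter_smul_right, inter_comm (lineClass n) ξ, inter_lineClass, hLL]
    have := mul_nonneg hpos.le h1
    have := mul_pos hpos hpos
    linarith

theorem nefCone_subset_nonnegCone : nefCone x ⊆ nonnegCone n := by
  intro α hα
  have h1 : 0 ≤ α.1 := by
    have := hα _ (isEffective_linePic (x := x))
    rwa [toN1_linePic, inter_lineClass] at this
  have hS : 0 ≤ ∑ i, α.2 i * α.2 i := Finset.sum_nonneg fun i _ => mul_self_nonneg _
  -- The null class `(s, α.2)` lies in `Q`, and pairing `α` with it gives `α.1 s ≥ s²`, that is `α²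
  -- ≥ 0`.
  set s := Real.sqrt (∑ i, α.2 i * α.2 i) with hs
  have hs0 : 0 ≤ s := Real.sqrt_nonneg _
  have hss : s * s = ∑ i, α.2 i * α.2 i := Real.mul_self_sqrt hS
  have hmem : ((s, α.2) : N1 n) ∈ nonnegCone n := by
    refine ⟨by rwa [inter_lineClass], ?_⟩
    simp only [inter, hss, sub_self, le_refl]
  have h2 := inter_nonneg_of_mem_nefCone hα (nonnegCone_subset_moriCone (x := x) hmem)
  simp only [inter, ← hss] at h2
  refine ⟨by rwa [inter_lineClass], ?_⟩
  simp only [inter, ← hss]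
  nlinarith

/-- On the orthogonal complement of a null vector the form is negative semidefinite. -/
theorem inter_self_eq_of_orthogonal {ξ η : N1 n} (hd : 0 < ξ.1) (h0 : inter ξ ξ = 0)
    (h : inter ξ η = 0) :
    inter η η = -∑ i, (η.2 i - η.1 / ξ.1 * ξ.2 i) ^ 2 := by
  -- Subtracting a multiple of `ξ` leaves the square unchanged; this multiple kills the
  -- `L`-coordinate, and the form is negative definite on the span of the exceptional classes.
  have h1 : inter (η - (η.1 / ξ.1) • ξ) (η - (η.1 / ξ.1) • ξ) = inter η η := by
    rw [inter_sub_left, inter_sub_right, inter_sub_right, inter_smul_left, inter_smul_left,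
      inter_smul_right, inter_smul_right, inter_comm η ξ, h, h0]
    ring
  rw [← h1, inter]
  have h2 : (η - (η.1 / ξ.1) • ξ).1 = 0 := by
    simp [hd.ne']
  rw [h2, zero_mul, zero_sub]
  simp [sq]

theorem inter_self_nonpos {ξ η : N1 n} (hd : 0 < ξ.1) (h0 : inter ξ ξ = 0)
    (h : inter ξ η = 0) : inter η η ≤ 0 := by
  rw [inter_self_eq_of_orthogonal hd h0 h]
  exact neg_nonpos.mpr (Finset.sum_nonneg fun i _ => sq_nonneg _)

theorem eq_smul_of_inter_eq_zero {ξ η : N1 n} (hd : 0 < ξ.1) (h0 : inter ξ ξ = 0)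
    (h : inter ξ η = 0) (h' : inter η η = 0) : η = (η.1 / ξ.1) • ξ := by
  rw [inter_self_eq_of_orthogonal hd h0 h, neg_eq_zero,
    Finset.sum_eq_zero_iff_of_nonneg fun i _ => sq_nonneg _] at h'
  ext i
  · simp [hd.ne']
  · have := pow_eq_zero_iff (two_ne_zero) |>.mp (h' i (Finset.mem_univ i))
    simp only [Prod.smul_snd, Pi.smul_apply, smul_eq_mul]
    linarith

theorem smul_mem_insert_ray (ξ : N1 n) {c : ℝ} (hc : 0 ≤ c) : c • ξ ∈ insert 0 (ray ξ) := by
  rcases hc.eq_or_lt with rfl | hc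
  · exact Or.inl (zero_smul ℝ ξ)
  · exact Or.inr ⟨c, hc, rfl⟩

theorem inter_self_eq_zero_of_mem_frontier {ξ : N1 n} (h : ξ ∈ frontier (nonnegCone n)) :
    0 ≤ ξ.1 ∧ inter ξ ξ = 0 := by
  have hmem : ξ ∈ nonnegCone n := isClosed_nonnegCone.frontier_subset h
  obtain ⟨h1, h2⟩ := hmem
  rw [inter_lineClass] at h1
  refine ⟨h1, ?_⟩
  by_contra hne
  have hpos : 0 < inter ξ ξ := lt_of_le_of_ne h2 (Ne.symm hne)
  have hd : 0 < ξ.1 := by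
    refine lt_of_le_of_ne h1 fun h0 => ?_
    have : 0 ≤ ∑ i, ξ.2 i * ξ.2 i := Finset.sum_nonneg fun i _ => mul_self_nonneg _
    simp only [inter, ← h0] at hpos
    linarith
  have hsub : {ξ : N1 n | 0 < ξ.1 ∧ 0 < inter ξ ξ} ⊆ nonnegCone n := fun η hη =>
    ⟨by rw [inter_lineClass]; exact hη.1.le, hη.2.le⟩
  exact h.2 (interior_maximal hsub isOpen_positiveCone ⟨hd, hpos⟩)

theorem fst_pos_of_inter_self_eq_zero {ξ : N1 n} (hne : ξ ≠ 0) (h1 : 0 ≤ ξ.1)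
    (h : inter ξ ξ = 0) : 0 < ξ.1 := by
  refine lt_of_le_of_ne h1 fun h0 => hne ?_
  simp only [inter, ← h0, mul_zero, zero_sub, neg_eq_zero] at h
  rw [Finset.sum_eq_zero_iff_of_nonneg fun i _ => mul_self_nonneg _] at h
  ext i
  · exact h0.symm
  · exact mul_self_eq_zero.mp (h i (Finset.mem_univ i))

end NonnegCone

end BlownUpPlane

/-! ### Null classes without effective multiples -/

namespace BlownUpPlane

variable {n : ℕ}

/-- Simultaneous Diophantine approximation of nonnegative real numbers. -/
theorem exists_nat_forall_abs_mul_sub_lt {ι : Type*} [Fintype ι] {t : ι → ℝ} (ht : ∀ i, 0 ≤ t i)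
    {ε : ℝ} (hε : 0 < ε) :
    ∃ (q : ℕ) (p : ι → ℕ), 0 < q ∧ ∀ i, |q * t i - p i| < ε := by
  let u : ℕ → ι → ℝ := fun k i => Int.fract (k * t i)
  have hu : ∀ k, u k ∈ Set.Icc (0 : ι → ℝ) 1 := fun k =>
    ⟨fun i => Int.fract_nonneg _, fun i => (Int.fract_lt_one _).le⟩
  -- By compactness the fractional parts for two indices are close; the difference of the indices
  -- serves as `q` and the differences of the floors as `p`.
  obtain ⟨a, -, φ, hφ, hlim⟩ := isCompact_Icc.tendsto_subseq hu
  obtain ⟨N, hN⟩ := Metric.cauchySeq_iff'.mp hlim.cauchySeq ε hε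
  have hlt : φ N < φ (N + 1) := hφ (Nat.lt_succ_self N)
  have hdist := hN (N + 1) (Nat.le_succ N)
  refine ⟨φ (N + 1) - φ N, fun i => (⌊φ (N + 1) * t i⌋ - ⌊φ N * t i⌋).toNat, by omega,
    fun i => ?_⟩
  have hfloor : ⌊φ N * t i⌋ ≤ ⌊φ (N + 1) * t i⌋ := by
    apply Int.floor_le_floor
    have : (φ N : ℝ) ≤ φ (N + 1) := by exact_mod_cast hlt.le
    exact mul_le_mul_of_nonneg_right this (ht i)
  have hcast : (((⌊φ (N + 1) * t i⌋ - ⌊φ N * t i⌋).toNat : ℕ) : ℝ) =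
      (⌊φ (N + 1) * t i⌋ : ℝ) - ⌊φ N * t i⌋ := by
    have := Int.toNat_of_nonneg (sub_nonneg.mpr hfloor)
    exact_mod_cast congrArg (Int.cast : ℤ → ℝ) this
  rw [hcast, Nat.cast_sub hlt.le]
  have h1 := (dist_pi_lt_iff hε).mp hdist i
  rw [Real.dist_eq] at h1
  convert h1 using 2
  simp only [u, Function.comp_apply, Int.fract]
  ring

section NonEffective

variable {x : Fin n → Plane} {D₀ : Pic n}

/-- A nonnegative real combination of effective classes that equals a positive multiple of an
integral class makes a multiple of that class effective. -/
theorem exists_nsmul_isEffective_of_sum_eq {ι : Type*} [Fintype ι] {f : ι → Pic n}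
    (hf : ∀ i, IsEffective x (f i)) {c : ι → ℝ} (hc : ∀ i, 0 ≤ c i)
    (hsum : ∑ i, c i • (f i).toN1 = D₀.toN1) : ∃ q : ℕ, 0 < q ∧ IsEffective x (q • D₀) := by
  set M : ℝ := ∑ i, ‖(f i).toN1‖
  have hM : 0 ≤ M := Finset.sum_nonneg fun i _ => norm_nonneg _
  obtain ⟨q, p, hq, hp⟩ := exists_nat_forall_abs_mul_sub_lt hc (ε := 1 / (M + 1)) (by positivity)
  refine ⟨q, hq, ?_⟩
  have hdiff : (q • D₀ - ∑ i, p i • f i).toN1 = ∑ i, (q * c i - p i) • (f i).toN1 := by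
    rw [Pic.toN1_sub, Pic.toN1_nsmul, Pic.toN1_sum, ← hsum, Finset.smul_sum,
      ← Finset.sum_sub_distrib]
    exact Finset.sum_congr rfl fun i _ => by rw [Pic.toN1_nsmul, smul_smul, sub_smul]
  have hnorm : ‖(q • D₀ - ∑ i, p i • f i).toN1‖ < 1 := by
    rw [hdiff]
    calc ‖∑ i, (q * c i - p i) • (f i).toN1‖
        ≤ ∑ i, ‖(q * c i - p i) • (f i).toN1‖ := norm_sum_le _ _
      _ ≤ ∑ i, 1 / (M + 1) * ‖(f i).toN1‖ := Finset.sum_le_sum fun i _ => by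
          rw [norm_smul]
          exact mul_le_mul_of_nonneg_right (hp i).le (norm_nonneg _)
      _ = M / (M + 1) := by rw [← Finset.mul_sum]; ring
      _ < 1 := by rw [div_lt_one (by positivity)]; linarith
  -- An integral class of norm less than `1` is zero, so the approximation is exact.
  have hzero : q • D₀ - ∑ i, p i • f i = 0 := by
    generalize q • D₀ - ∑ i, p i • f i = D at hnorm
    have h1 : |(D.1 : ℝ)| < 1 := (norm_fst_le D.toN1).trans_lt hnorm
    have h2 : ∀ i, |(D.2 i : ℝ)| < 1 := fun i =>
      ((norm_le_pi_norm D.toN1.2 i).trans (norm_snd_le D.toN1)).trans_lt hnorm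
    ext i
    · exact Int.abs_lt_one_iff.mp (by exact_mod_cast h1)
    · exact Int.abs_lt_one_iff.mp (by exact_mod_cast h2 i)
  rw [sub_eq_zero.mp hzero]
  exact .sum _ fun i _ => (hf i).nsmul _

theorem mem_nefCone_of_not_isEffective (hd : 0 < D₀.1) (hsq : inter D₀.toN1 D₀.toN1 = 0)
    (hne : ∀ k : ℕ, 0 < k → ¬ IsEffective x (k • D₀)) : D₀.toN1 ∈ nefCone x := by
  intro D hD
  by_contra hneg
  rw [not_le] at hneg
  -- The first bound makes the degree of `N D₀ - D` positive, the second its square `-2 N (D₀ · D) +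
  -- D²`.
  obtain ⟨N, hN⟩ := exists_nat_gt
    (max (D.1 : ℝ) (-(inter D.toN1 D.toN1) / (-(2 * inter D₀.toN1 D.toN1))))
  obtain ⟨hN1, hN2⟩ := max_lt_iff.mp hN
  rw [div_lt_iff₀ (by linarith)] at hN2
  have hN1' : D.1 < N := by exact_mod_cast hN1
  have hN0 : 0 < N := by
    have := hD.degree_nonneg
    omega
  obtain ⟨k, hk, hkE⟩ := exists_nsmul_isEffective (x := x) (D := N • D₀ - D)
    (by
      have : (N • D₀ - D).1 = N * D₀.1 - D.1 := by simp
      rw [this]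
      nlinarith)
    (by
      rw [Pic.toN1_sub, Pic.toN1_nsmul, inter_sub_left, inter_sub_right, inter_sub_right,
        inter_smul_left, inter_smul_left, inter_smul_right, inter_smul_right, hsq,
        inter_comm D.toN1 D₀.toN1]
      linarith)
  have := hkE.add (hD.nsmul k)
  rw [← smul_add, sub_add_cancel, smul_smul] at this
  exact hne _ (Nat.mul_pos hk hN0) this

theorem inter_canonicalClass_nonneg (hd : 0 < D₀.1) (hsq : inter D₀.toN1 D₀.toN1 = 0)
    (hne : ∀ k : ℕ, 0 < k → ¬ IsEffective x (k • D₀)) :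
    0 ≤ inter D₀.toN1 (canonicalClass n) := by
  by_contra hneg
  refine hne 1 one_pos ?_
  rw [one_smul]
  exact isEffective_of_canonical_le hd.le (by rw [hsq]; exact (not_le.mp hneg).le)

theorem isExtremalRay_nefCone (hd : 0 < D₀.1) (hsq : inter D₀.toN1 D₀.toN1 = 0)
    (hnef : D₀.toN1 ∈ nefCone x) : IsExtremalRay (nefCone x) (ray D₀.toN1) := by
  have hd' : 0 < D₀.toN1.1 := by simpa [Pic.toN1] using hd
  refine ⟨?_, ?_⟩
  · rintro _ ⟨c, hc, rfl⟩ D hD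
    rw [inter_smul_left]
    exact mul_nonneg hc.le (hnef D hD)
  have key : ∀ α ∈ nefCone x, ∀ β ∈ nefCone x, α + β ∈ ray D₀.toN1 →
      α ∈ insert 0 (ray D₀.toN1) := by
    rintro α hα β hβ ⟨c, hc, hsum⟩
    have hαQ := nefCone_subset_nonnegCone hα
    have hβQ := nefCone_subset_nonnegCone hβ
    have hαβ := inter_nonneg_of_mem_nefCone hα (nonnegCone_subset_moriCone hβQ)
    have htot : inter (α + β) (α + β) = 0 := by
      rw [hsum, inter_smul_left, inter_smul_right, hsq, mul_zero, mul_zero]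
    rw [inter_add_left, inter_add_right, inter_add_right, inter_comm β α] at htot
    have h1 := hαQ.2
    have h2 := hβQ.2
    have hαα : inter α α = 0 := by linarith
    have hαβ0 : inter α β = 0 := by linarith
    have horth : inter D₀.toN1 α = 0 := by
      have : inter (c • D₀.toN1) α = 0 := by
        rw [← hsum, inter_add_left, hαα, inter_comm β, hαβ0, add_zero]
      rw [inter_smul_left] at this
      exact (mul_eq_zero.mp this).resolve_left hc.ne'
    rw [eq_smul_of_inter_eq_zero hd' hsq horth hαα]
    refine smul_mem_insert_ray _ (div_nonneg ?_ hd'.le)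
    have := hαQ.1
    rwa [inter_lineClass] at this
  exact fun α hα β hβ h => ⟨key α hα β hβ h, key β hβ α hα (add_comm α β ▸ h)⟩

/-- Nonzero effective classes admit no nontrivial nonnegative combination on the line of `D₀`. -/
theorem eq_zero_of_sum_smul_eq (hd : 0 < D₀.1) (hsq : inter D₀.toN1 D₀.toN1 = 0)
    (hne : ∀ k : ℕ, 0 < k → ¬ IsEffective x (k • D₀)) {ι : Type*} [Fintype ι] {f : ι → Pic n}
    (hf : ∀ i, IsEffective x (f i)) (hf0 : ∀ i, f i ≠ 0) {c : ι → ℝ} (hc : ∀ i, 0 ≤ c i) {r : ℝ}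
    (hsum : ∑ i, c i • (f i).toN1 = r • D₀.toN1) (i : ι) : c i = 0 := by
  -- A positive `r` would make a multiple of `D₀` effective. For `r ≤ 0`, pairing with the ample
  -- class forces every term to vanish.
  have hr : r ≤ 0 := by
    by_contra hr
    rw [not_le] at hr
    obtain ⟨q, hq, hqE⟩ := exists_nsmul_isEffective_of_sum_eq (D₀ := D₀) hf
      (c := fun i => r⁻¹ * c i) (fun i => mul_nonneg (inv_nonneg.mpr hr.le) (hc i)) (by
        simp only [mul_smul, ← Finset.smul_sum, hsum]
        rw [smul_smul, inv_mul_cancel₀ hr.ne', one_smul])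
    exact hne q hq hqE
  have hmori : D₀.toN1 ∈ moriCone x := by
    refine nonnegCone_subset_moriCone ⟨?_, hsq.ge⟩
    rw [inter_lineClass]
    simpa [Pic.toN1] using hd.le
  have hA := congrArg (inter (ampleClass n)) hsum
  rw [inter_sum_right, inter_smul_right] at hA
  have hle : ∑ i, inter (ampleClass n) (c i • (f i).toN1) ≤ 0 := by
    rw [hA]
    exact mul_nonpos_of_nonpos_of_nonneg hr
      (inter_nonneg_of_mem_nefCone ampleClass_mem_nefCone hmori)
  have hnn : ∀ i ∈ Finset.univ, 0 ≤ inter (ampleClass n) (c i • (f i).toN1) := fun i _ => by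
    rw [inter_smul_right]
    exact mul_nonneg (hc i) (inter_ampleClass_pos (hf i) (hf0 i)).le
  have h0 := (Finset.sum_eq_zero_iff_of_nonneg hnn).mp
    (le_antisymm hle (Finset.sum_nonneg hnn)) i (Finset.mem_univ i)
  rw [inter_smul_right] at h0
  exact (mul_eq_zero.mp h0).resolve_right (inter_ampleClass_pos (hf i) (hf0 i)).ne'

/-- The irreducible curves that do not meet a class. -/
abbrev OrthogonalCurve (x : Fin n → Plane) (ξ : N1 n) : Type :=
  {C : Pic n // IsCurve x C ∧ inter ξ C.toN1 = 0}

/-- Separating signs in a relation writes one class `P` as two nonnegative combinations without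
common curves, so `P² ≥ 0`. As `P` is orthogonal to `D₀`, it is a multiple of `D₀`, and
`eq_zero_of_sum_smul_eq` kills both combinations. -/
theorem linearIndependent_orthogonalCurve (hx : Function.Injective x) (hd : 0 < D₀.1)
    (hsq : inter D₀.toN1 D₀.toN1 = 0) (hne : ∀ k : ℕ, 0 < k → ¬ IsEffective x (k • D₀)) :
    LinearIndependent ℝ fun C : OrthogonalCurve x D₀.toN1 => C.1.toN1 := by
  rw [linearIndependent_iff']
  intro s g hg C hC
  have hd' : 0 < D₀.toN1.1 := by simpa [Pic.toN1] using hd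
  set P := ∑ C : s, (g C)⁺ • C.1.1.toN1 with hP
  have hP' : P = ∑ C : s, (g C)⁻ • C.1.1.toN1 := by
    rw [← sub_eq_zero, hP, ← Finset.sum_sub_distrib, ← hg,
      ← Finset.sum_coe_sort s fun C => g C • C.1.toN1]
    exact Finset.sum_congr rfl fun C _ => by rw [← sub_smul, posPart_sub_negPart]
  have horth : inter D₀.toN1 P = 0 := by
    rw [hP, inter_sum_right]
    exact Finset.sum_eq_zero fun C _ => by rw [inter_smul_right, C.1.2.2, mul_zero]
  have hnn : 0 ≤ inter P P := by
    nth_rewrite 2 [hP']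
    rw [hP, inter_sum_left]
    refine Finset.sum_nonneg fun C _ => ?_
    rw [inter_sum_right]
    refine Finset.sum_nonneg fun C' _ => ?_
    rw [inter_smul_left, inter_smul_right]
    by_cases h : C = C'
    · subst h
      rcases le_total (g C) 0 with hC | hC
      · simp [posPart_eq_zero.mpr hC]
      · simp [negPart_eq_zero.mpr hC]
    · refine mul_nonneg (posPart_nonneg _) (mul_nonneg (negPart_nonneg _) ?_)
      exact C.1.2.1.inter_nonneg hx C'.1.2.1 fun h' => h (Subtype.ext (Subtype.ext h'))
  have hPP : inter P P = 0 := le_antisymm (inter_self_nonpos hd' hsq horth) hnn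
  have hPξ := eq_smul_of_inter_eq_zero hd' hsq horth hPP
  have h1 := eq_zero_of_sum_smul_eq hd hsq hne (f := fun C : s => C.1.1)
    (fun C => C.1.2.1.isEffective) (fun C => C.1.2.1.ne_zero) (fun C => posPart_nonneg (g C))
    (hP.symm.trans hPξ) ⟨C, hC⟩
  have h2 := eq_zero_of_sum_smul_eq hd hsq hne (f := fun C : s => C.1.1)
    (fun C => C.1.2.1.isEffective) (fun C => C.1.2.1.ne_zero) (fun C => negPart_nonneg (g C))
    (hP'.symm.trans hPξ) ⟨C, hC⟩
  rw [← posPart_sub_negPart (g C), h1, h2, sub_zero]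

/-- Subtract from `α` as much of the orthogonal curves as the Mori cone allows. The remainder has
square zero and is orthogonal to `D₀`, hence is a multiple of `D₀`. -/
theorem exists_eq_smul_add_sum (hx : Function.Injective x) (hd : 0 < D₀.1)
    (hsq : inter D₀.toN1 D₀.toN1 = 0) (hnef : D₀.toN1 ∈ nefCone x)
    [Fintype (OrthogonalCurve x D₀.toN1)] {α : N1 n} (hα : α ∈ moriCone x)
    (horth : inter D₀.toN1 α = 0) :
    ∃ (a : ℝ) (t : OrthogonalCurve x D₀.toN1 → ℝ), 0 ≤ a ∧ (∀ C, 0 ≤ t C) ∧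
      α = a • D₀.toN1 + ∑ C, t C • C.1.toN1 := by
  classical
  have hd' : 0 < D₀.toN1.1 := by simpa [Pic.toN1] using hd
  let S : Set (OrthogonalCurve x D₀.toN1 → ℝ) :=
    {t | (∀ C, 0 ≤ t C) ∧ α - ∑ C, t C • C.1.toN1 ∈ moriCone x}
  have hpos : ∀ C : OrthogonalCurve x D₀.toN1, 0 < inter (ampleClass n) C.1.toN1 := fun C =>
    inter_ampleClass_pos C.2.1.isEffective C.2.1.ne_zero
  have hSclosed : IsClosed S := by
    refine IsClosed.and ?_ (isClosed_moriCone.preimage (by fun_prop))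
    have : {t : OrthogonalCurve x D₀.toN1 → ℝ | ∀ C, 0 ≤ t C} = Set.Ici 0 := rfl
    rw [this]
    exact isClosed_Ici
  -- The ample degree of `α` bounds the multiple of each curve that can be removed, so a maximum of
  -- the total is attained.
  have hSbdd : S ⊆ Set.Icc 0
      fun C => inter (ampleClass n) α / inter (ampleClass n) C.1.toN1 := by
    rintro t ⟨ht, hmem⟩
    refine ⟨ht, fun C => ?_⟩
    rw [le_div_iff₀ (hpos C)]
    have h1 := inter_nonneg_of_mem_nefCone ampleClass_mem_nefCone hmem
    rw [inter_sub_right, inter_sum_right] at h1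
    have h2 := Finset.single_le_sum (f := fun C : OrthogonalCurve x D₀.toN1 =>
      inter (ampleClass n) (t C • C.1.toN1))
      (fun C _ => by rw [inter_smul_right]; exact mul_nonneg (ht C) (hpos C).le)
      (Finset.mem_univ C)
    simp only [inter_smul_right] at h1 h2
    linarith
  have hScomp : IsCompact S := isCompact_Icc.of_isClosed_subset hSclosed hSbdd
  have hSne : S.Nonempty := ⟨0, fun _ => le_rfl, by simpa using hα⟩
  obtain ⟨t, ⟨ht, hmem⟩, hmax⟩ := hScomp.exists_isMaxOn hSne
    (f := fun t => ∑ C, t C) (by fun_prop)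
  set α' := α - ∑ C, t C • C.1.toN1 with hα'
  have horth' : inter D₀.toN1 α' = 0 := by
    rw [hα', inter_sub_right, horth, inter_sum_right, zero_sub, neg_eq_zero]
    exact Finset.sum_eq_zero fun C _ => by rw [inter_smul_right, C.2.2, mul_zero]
  have hself : inter α' α' = 0 := by
    refine le_antisymm (inter_self_nonpos hd' hsq horth') ?_
    by_contra hneg
    -- A remainder of negative square is not nef, so some curve `C` meets it negatively and can be
    -- subtracted further. Nefness of `D₀` forces `D₀ · C = 0`, which contradicts maximality.
    obtain ⟨C, hC, hCneg⟩ : ∃ C, IsCurve x C ∧ inter α' C.toN1 < 0 := by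
      by_contra hall
      push Not at hall
      exact hneg (inter_nonneg_of_mem_nefCone (mem_nefCone_of_forall_isCurve hall) hmem)
    obtain ⟨hCC, hsub⟩ := hC.sub_smul_mem_moriCone hx hmem hCneg
    set r := inter α' C.toN1 / inter C.toN1 C.toN1
    have hr : 0 < r := div_pos_of_neg_of_neg hCneg hCC
    have hCξ : inter D₀.toN1 C.toN1 = 0 := by
      have h1 := inter_nonneg_of_mem_nefCone hnef hsub
      rw [inter_sub_right, horth', inter_smul_right] at h1
      have h2 := hnef C hC.isEffective
      nlinarith
    let C' : OrthogonalCurve x D₀.toN1 := ⟨C, hC, hCξ⟩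
    let t' : OrthogonalCurve x D₀.toN1 → ℝ := t + Pi.single C' r
    have hS' : t' ∈ S := by
      refine ⟨fun B => add_nonneg (ht B) ?_, ?_⟩
      · rw [Pi.single_apply]
        split_ifs
        exacts [hr.le, le_rfl]
      · have : ∑ B, t' B • B.1.toN1 = ∑ B, t B • B.1.toN1 + r • C.toN1 := by
          simp only [t', Pi.add_apply, add_smul, Finset.sum_add_distrib, Pi.single_apply, ite_smul,
            zero_smul, Finset.sum_ite_eq', Finset.mem_univ, if_true]
          rfl
        rw [this, ← sub_sub]
        exact hsub
    have h1 : ∑ B, t' B ≤ ∑ B, t B := hmax hS'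
    simp only [t', Pi.add_apply, Finset.sum_add_distrib, Finset.sum_pi_single', Finset.mem_univ,
      if_true] at h1
    linarith
  refine ⟨α'.1 / D₀.toN1.1, t, div_nonneg (fst_nonneg_of_mem_moriCone hmem) hd'.le, ht, ?_⟩
  rw [← eq_smul_of_inter_eq_zero hd' hsq horth' hself, hα', sub_add_cancel]

theorem isExtremalRay_moriCone (hx : Function.Injective x) (hd : 0 < D₀.1)
    (hsq : inter D₀.toN1 D₀.toN1 = 0) (hne : ∀ k : ℕ, 0 < k → ¬ IsEffective x (k • D₀))
    (hsub : ray D₀.toN1 ⊆ moriCone x) : IsExtremalRay (moriCone x) (ray D₀.toN1) := by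
  have hnef := mem_nefCone_of_not_isEffective hd hsq hne
  have hfin : Finite (OrthogonalCurve x D₀.toN1) :=
    (linearIndependent_orthogonalCurve hx hd hsq hne).finite
  have := Fintype.ofFinite (OrthogonalCurve x D₀.toN1)
  refine ⟨hsub, ?_⟩
  rintro α hα β hβ ⟨c, hc, hsum⟩
  have hα0 := inter_nonneg_of_mem_nefCone hnef hα
  have hβ0 := inter_nonneg_of_mem_nefCone hnef hβ
  have htot : inter D₀.toN1 α + inter D₀.toN1 β = 0 := by
    rw [← inter_add_right, hsum, inter_smul_right, hsq, mul_zero]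
  obtain ⟨a, t, ha, ht, hαt⟩ := exists_eq_smul_add_sum hx hd hsq hnef hα (by linarith)
  obtain ⟨b, t', hb, ht', hβt⟩ := exists_eq_smul_add_sum hx hd hsq hnef hβ (by linarith)
  -- The curve parts of `α` and `β` add up to a multiple of `D₀`, so all their coefficients vanish.
  have hzero := eq_zero_of_sum_smul_eq hd hsq hne
    (f := fun C : OrthogonalCurve x D₀.toN1 => C.1) (fun C => C.2.1.isEffective)
    (fun C => C.2.1.ne_zero) (c := t + t') (fun C => add_nonneg (ht C) (ht' C)) (r := c - a - b)
    (by
      simp only [Pi.add_apply, add_smul, Finset.sum_add_distrib, sub_smul]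
      rw [← hsum, hαt, hβt]
      abel)
  have h1 : ∀ C, t C = 0 := fun C => by
    have h := hzero C
    have := ht C
    have := ht' C
    simp only [Pi.add_apply] at h
    linarith
  have h2 : ∀ C, t' C = 0 := fun C => by
    have h := hzero C
    have := ht C
    have := ht' C
    simp only [Pi.add_apply] at h
    linarith
  simp only [h1, zero_smul, Finset.sum_const_zero, add_zero] at hαt
  simp only [h2, zero_smul, Finset.sum_const_zero, add_zero] at hβt
  rw [hαt, hβt]
  exact ⟨smul_mem_insert_ray _ ha, smul_mem_insert_ray _ hb⟩

end NonEffective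

theorem ray_smul (ξ : N1 n) {c : ℝ} (hc : 0 < c) : ray (c • ξ) = ray ξ := by
  ext η
  constructor
  · rintro ⟨t, ht, rfl⟩
    exact ⟨t * c, mul_pos ht hc, smul_smul t c ξ⟩
  · rintro ⟨t, ht, rfl⟩
    exact ⟨t * c⁻¹, mul_pos ht (inv_pos.mpr hc), by rw [smul_smul, mul_assoc,
      inv_mul_cancel₀ hc.ne', mul_one]⟩

end BlownUpPlane

theorem mainTheorem10 (n : ℕ) (x : Fin n → BlownUpPlane.Plane) (hx : Function.Injective x)
    (ρ : Set (BlownUpPlane.N1 n)) (hrat : BlownUpPlane.IsRationalRay ρ)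
    (hbd : ρ ⊆ frontier (BlownUpPlane.nonnegCone n))
    (hneff : ¬ BlownUpPlane.IsEffectiveRay x ρ) :
    ρ ⊆ BlownUpPlane.nefCone x ∧
    BlownUpPlane.IsExtremalRay (BlownUpPlane.moriCone x) ρ ∧
    BlownUpPlane.IsExtremalRay (BlownUpPlane.nefCone x) ρ ∧
    ρ ⊆ frontier (BlownUpPlane.nonnegCone n) ∩ BlownUpPlane.moriConeKNonneg x := by
  open BlownUpPlane in
  obtain ⟨ξ, hξ0, hξ, hρ⟩ := hrat
  obtain ⟨N, D, hN, hD⟩ := hξ.exists_toN1_eq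
  have hN' : (0 : ℝ) < N := by exact_mod_cast hN
  obtain rfl : ρ = ray D.toN1 := by rw [hρ, hD, ray_smul ξ hN']
  have hD0 : D.toN1 ≠ 0 := by
    rw [hD]
    exact smul_ne_zero hN'.ne' hξ0
  obtain ⟨h1, hsq⟩ := inter_self_eq_zero_of_mem_frontier
    (hbd ⟨1, one_pos, (one_smul ℝ D.toN1).symm⟩)
  have hd : 0 < D.1 := by
    have := fst_pos_of_inter_self_eq_zero hD0 h1 hsq
    simpa [Pic.toN1] using this
  have hne : ∀ k : ℕ, 0 < k → ¬ IsEffective x (k • D) := by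
    intro k hk hE
    have hk' : (0 : ℝ) < k := by exact_mod_cast hk
    refine hneff ⟨k • D, fun h0 => ?_, hE, by rw [Pic.toN1_nsmul, ray_smul _ hk']⟩
    rw [← Pic.toN1_injective.eq_iff, Pic.toN1_nsmul, Pic.toN1_zero] at h0
    exact smul_ne_zero hk'.ne' hD0 h0
  have hnef := isExtremalRay_nefCone hd hsq (mem_nefCone_of_not_isEffective hd hsq hne)
  have hmori : ray D.toN1 ⊆ moriCone x := fun η hη =>
    nonnegCone_subset_moriCone (isClosed_nonnegCone.frontier_subset (hbd hη))
  refine ⟨hnef.1, isExtremalRay_moriCone hx hd hsq hne hmori, hnef,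
    fun η hη => ⟨hbd hη, hmori hη, ?_⟩⟩
  obtain ⟨c, hc, rfl⟩ := hη
  rw [inter_smul_left]
  exact mul_nonneg hc.le (inter_canonicalClass_nonneg hd hsq hne)
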